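/- Let $n\ge 1$, $1\le p<\infty$, and let $m=m(x,h)\in L^\infty(\mathbb R^n\times\mathbb R^n)$ satisfy: (H1) there are constants $0<m_-\le m_+<\infty$ with $m_-\le m(x,h)\le m_+$ for a.e. $(x,h)$; (H2) $m(x,h)=m(x-h,-h)$ for a.e. $(x,h)$; (H3) there is a function $a:\mathbb R^n\times\mathbb S^{n-1}\to\mathbb R$ (the radial limit of $m$) such that $m(x,r\omega)=a(x,\omega)+O(r)$ as $r\downarrow 0$, uniformly in $\omega\in\mathbb S^{n-1}$; that is, for a.e. $x$ there are $C_x\in\mathbb R$ and $\delta_x>0$ with $|m(x,r\omega)-a(x,\omega)|\le C_x r$ for a.e. $\omega\in\mathbb S^{n-1}$ and a.e. $r\in(0,\delta_x)$. Put $$\mathcal A(x,\xi)=\frac1p\int_{\mathbb S^{n-1}}a(x,\omega)\,|\xi\cdot\omega|^p\,d\mathcal H^{n-1}(\omega),$$ where $\mathcal H^{n-1}$ is the surface measure of the unit sphere $\mathbb S^{n-1}$. Let $u\in L^p(\mathbb R^n)$ be real-valued. (i) If $u\in W^{1,p}(\mathbb R^n)$, then $x\mapsto\mathcal A(x,\nabla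 u(x))$ is integrable on $\mathbb R^n$ and $$\lim_{s\uparrow1}\,(1-s)\iint_{\mathbb R^n\times\mathbb R^n}m(x,h)\,\frac{|u(x)-u(x-h)|^p}{|h|^{n+sp}}\,dx\,dh=\int_{\mathbb R^n}\mathcal A(x,\nabla u(x))\,dx .$$ (ii) If $p>1$ and $u\notin W^{1,p}(\mathbb R^n)$, then $$\lim_{s\uparrow1}\,(1-s)\iint_{\mathbb R^n\times\mathbb R^n}m(x,h)\,\frac{|u(x)-u(x-h)|^p}{|h|^{n+sp}}\,dx\,dh=+\infty .$$ -/

import Mathlib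

open MeasureTheory Filter Topology Metric
open scoped ENNReal

/-- The Euclidean space `ℝⁿ`. -/
abbrev Eucl (n : ℕ) : Type := EuclideanSpace ℝ (Fin n)

/-- The unit sphere `S^{n-1}` of `ℝⁿ`. -/
abbrev USphere (n : ℕ) : Type := sphere (0 : Eucl n) 1

/-- The surface measure of the unit sphere, that is, the `(n-1)`-dimensional Hausdorff measure on
the sphere in its usual normalization: it is the measure of polar coordinates, and the whole sphere
has measure `n ω_n`. (Mathlib's `μH[n - 1]` differs from it by a dimensional factor.) -/
noncomputable abbrev surfaceMeasure (n : ℕ) : Measure (USphere n) :=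
  (volume : Measure (Eucl n)).toSphere

/-- `m₋ ≤ m ≤ m₊` almost everywhere, for some constants `0 < m₋ ≤ m₊ < ∞`. -/
def KernelBounded {n : ℕ} (m : Eucl n × Eucl n → ℝ) : Prop :=
  ∃ mlo mhi : ℝ, 0 < mlo ∧ mlo ≤ mhi ∧ ∀ᵐ z : Eucl n × Eucl n, mlo ≤ m z ∧ m z ≤ mhi

/-- `m(x, h) = m(x - h, -h)` almost everywhere. -/
def KernelSymmetric {n : ℕ} (m : Eucl n × Eucl n → ℝ) : Prop :=
  ∀ᵐ z : Eucl n × Eucl n, m z = m (z.1 - z.2, -z.2)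

/-- `a` is the radial limit of `m`: `m(x, rω) = a(x, ω) + O(r)` as `r ↓ 0`, uniformly in `ω`.
The constants of the `O(r)` may depend on `x`. -/
def HasRadialLimit {n : ℕ} (m : Eucl n × Eucl n → ℝ) (a : Eucl n → USphere n → ℝ) : Prop :=
  ∀ᵐ x : Eucl n, ∃ C δ : ℝ, 0 < δ ∧
    ∀ᵐ ω : USphere n ∂(surfaceMeasure n), ∀ᵐ r : ℝ, 0 < r → r < δ →
      |m (x, r • (ω : Eucl n)) - a x ω| ≤ C * r

/-- `g` is the weak (distributional) gradient of `u` on `ℝⁿ`; this is meant for locally integrable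
`u` and `g`. -/
def IsWeakGradient {n : ℕ} (u : Eucl n → ℝ) (g : Eucl n → Eucl n) : Prop :=
  ∀ φ : Eucl n → ℝ, ContDiff ℝ ((⊤ : ℕ∞) : WithTop ℕ∞) φ → HasCompactSupport φ → ∀ v : Eucl n,
    ∫ x, u x * fderiv ℝ φ x v = -∫ x, φ x * inner ℝ (g x) v

/-- The Sobolev space `W^{1,p}(ℝⁿ)`: `u` and its weak gradient belong to `L^p`. -/
def MemW1p {n : ℕ} (p : ℝ) (u : Eucl n → ℝ) : Prop :=
  MemLp u (ENNReal.ofReal p) ∧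
    ∃ g : Eucl n → Eucl n, IsWeakGradient u g ∧ MemLp g (ENNReal.ofReal p)

/-- The anisotropic fractional energy `∬ m(x,h) |u(x) - u(x-h)|^p / |h|^{n+sp} dx dh`, with values
in `[0, ∞]`. -/
noncomputable def anisoEnergy {n : ℕ} (m : Eucl n × Eucl n → ℝ) (s p : ℝ) (u : Eucl n → ℝ) :
    ℝ≥0∞ :=
  ∫⁻ z : Eucl n × Eucl n,
    ENNReal.ofReal (m z * (|u z.1 - u (z.1 - z.2)| ^ p / ‖z.2‖ ^ ((n : ℝ) + s * p)))

/-- `𝒜(x, ξ) = (1/p) ∫_{S^{n-1}} a(x, ω) |ξ · ω|^p dℋ^{n-1}(ω)`. -/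
noncomputable def limitDensity {n : ℕ} (p : ℝ) (a : Eucl n → USphere n → ℝ) (x ξ : Eucl n) : ℝ :=
  (1 / p) * ∫ ω : USphere n, a x ω * |inner ℝ ξ (ω : Eucl n)| ^ p ∂(surfaceMeasure n)

/-! Put `κ = p (1 - s)`. Then `|h|^{-(n+sp)} = |h|^{κ-n} |h|^{-p}`, so `1 - s` times the part of the
energy with `|h| < 1` equals `1/p` times the integral of `m |diffQuot u|^p` against `dx ⊗
polarKernel n κ` (`near_energy_eq`). The measures `κ |h|^{κ-n} dh` on the unit ball all have the
mass of the sphere and concentrate at the origin as `κ ↓ 0`. The part with `|h| ≥ 1` is bounded for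
`s` near `1` and is killed by the factor `1 - s` (`tendsto_far_energy`).

If `u` has a weak gradient `g` in `L^p`, the fundamental theorem of calculus along segments and
continuity of translations in `L^p` show that `diffQuot u` and `linQuot g` differ by `o(1)` in
`L^p(dx)` as `h → 0`, hence by `o(1)` in the norm of the product measure
(`tendsto_lintegral_diffQuot_sub_linQuot`). By Minkowski it suffices to treat `linQuot g`
(`tendsto_near_energy`). This is constant along rays, so for fixed `x` only the radial limit of `m`
matters; dominated convergence with majorant a multiple of `‖g‖^p` gives the limit
(`tendsto_linear_energy`).

For the converse, if the energies do not diverge they are bounded along some `s_k ↑ 1`, and the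
lower bound on `m` bounds `diffQuot u` in `L^p` of the product measures. Averaging `diffQuot u` in
`h` with weight `⟨v, h⟩/|h|` gives, by Jensen, a bounded sequence in `L^p(dx)`, which for `p > 1`
has a weak cluster point (`exists_memLp_weak_cluster`). Tested against smooth `φ`, the difference
moves onto `φ`, and the pairings tend to `-∫ u ∂_w φ`, where `w = sphereMoment n v`
(`tendsto_integral_quotPairing`). As `sphereMoment n` is onto, all directional derivatives of `u`
lie in `L^p` (`exists_weak_directional_derivative`). -/

/-! ### Duality of `L^p` and `L^q`, and weak compactness. -/

section LpDuality

theorem Real.HolderConjugate.ennreal_ofReal_holderConjugate {p q : ℝ} (hpq : p.HolderConjugate q) :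
    (ENNReal.ofReal p).HolderConjugate (ENNReal.ofReal q) := by
  rw [ENNReal.holderConjugate_iff, ← ENNReal.ofReal_inv_of_pos hpq.pos,
    ← ENNReal.ofReal_inv_of_pos hpq.symm.pos,
    ← ENNReal.ofReal_add (inv_nonneg.2 hpq.pos.le) (inv_nonneg.2 hpq.symm.pos.le),
    hpq.inv_add_inv_eq_one, ENNReal.ofReal_one]

variable {α : Type*} [MeasurableSpace α] {μ : Measure α} {p q : ℝ}

/-- Dominated convergence in `L^q`. -/
theorem tendsto_toLp_of_dominated (hq : 1 ≤ q) {ι : Type*} {l : Filter ι}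
    [l.IsCountablyGenerated] {F : ι → α → ℝ} {f b : α → ℝ} (hb : MemLp b (ENNReal.ofReal q) μ)
    (hF : ∀ i, MemLp (F i) (ENNReal.ofReal q) μ) (hf : MemLp f (ENNReal.ofReal q) μ)
    (hbound : ∀ i, ∀ᵐ x ∂μ, ‖F i x‖ ≤ b x)
    (hlim : ∀ᵐ x ∂μ, Tendsto (fun i => F i x) l (𝓝 (f x))) :
    have : Fact (1 ≤ ENNReal.ofReal q) := ⟨by simpa using hq⟩
    Tendsto (fun i => (hF i).toLp (F i)) l (𝓝 (hf.toLp f)) := by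
  have : Fact (1 ≤ ENNReal.ofReal q) := ⟨by simpa using hq⟩
  have hq0 : 0 < q := by linarith
  have hq' : ENNReal.ofReal q ≠ 0 := by simpa using hq0
  have e : ∀ g : α → ℝ, eLpNorm g (ENNReal.ofReal q) μ = (∫⁻ x, ‖g x‖ₑ ^ q ∂μ) ^ (1 / q) := by
    intro g
    rw [eLpNorm_eq_lintegral_rpow_enorm_toReal hq' ENNReal.ofReal_ne_top,
      ENNReal.toReal_ofReal hq0.le]
  rw [Lp.tendsto_Lp_iff_tendsto_eLpNorm'']
  -- The index type may be uncountable, so the bounds need not hold simultaneously almost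
  -- everywhere. They do along a sequence tending to `l`, which exists usefully only if `l` is
  -- nontrivial.
  have hbf : ∀ᵐ x ∂μ, ‖f x‖ₑ ≤ ‖b x‖ₑ ∨ l = ⊥ := by
    by_cases hl : l = ⊥
    · simp [hl]
    have : l.NeBot := ⟨hl⟩
    obtain ⟨v, hv⟩ := l.exists_seq_tendsto
    have := ae_all_iff.2 (fun k => hbound (v k))
    filter_upwards [this, hlim] with x hx hx'
    left
    have h3 : Tendsto (fun k => ‖F (v k) x‖) atTop (𝓝 ‖f x‖) := (hx'.comp hv).norm
    have h4 : ‖f x‖ ≤ b x := le_of_tendsto' h3 hx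
    rw [enorm_le_iff_norm_le]
    exact h4.trans (le_abs_self _)
  by_cases hl : l = ⊥
  · simp [hl]
  simp only [hl, or_false] at hbf
  have key : Tendsto (fun i => ∫⁻ x, ‖(F i - f) x‖ₑ ^ q ∂μ) l (𝓝 (∫⁻ x, 0 ∂μ)) := by
    refine tendsto_lintegral_filter_of_dominated_convergence'
      (fun x => (2 * ‖b x‖ₑ) ^ q) ?_ ?_ ?_ ?_
    · exact Eventually.of_forall fun i => (((hF i).1.sub hf.1).enorm).pow_const q
    · refine Eventually.of_forall fun i => ?_
      filter_upwards [hbound i, hbf] with x hx hx'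
      refine ENNReal.rpow_le_rpow ?_ hq0.le
      calc ‖(F i - f) x‖ₑ ≤ ‖F i x‖ₑ + ‖f x‖ₑ := enorm_sub_le
        _ ≤ ‖b x‖ₑ + ‖b x‖ₑ := by
          gcongr
          rw [enorm_le_iff_norm_le]
          exact hx.trans (le_abs_self _)
        _ = _ := (two_mul _).symm
    · simp_rw [ENNReal.mul_rpow_of_nonneg _ _ hq0.le]
      rw [lintegral_const_mul' _ _ (by simp)]
      refine ENNReal.mul_ne_top (by simp) ?_
      have := hb.eLpNorm_lt_top
      rw [e] at this
      intro h
      rw [h] at this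
      simp [hq0] at this
    · filter_upwards [hlim] with x hx
      have h1 : Tendsto (fun i => F i x - f x) l (𝓝 (f x - f x)) := hx.sub_const _
      rw [sub_self] at h1
      have h2 := (ENNReal.continuous_rpow_const (y := q)).tendsto _ |>.comp h1.enorm
      simpa [hq0, Function.comp_def] using h2
  simp only [lintegral_zero] at key
  have h2 := (ENNReal.continuous_rpow_const (y := 1 / q)).tendsto _ |>.comp key
  simp only [ENNReal.zero_rpow_of_pos (one_div_pos.2 hq0)] at h2
  refine h2.congr fun i => ?_
  rw [e]
  rfl

/-- A bounded linear functional on `L^q`, applied to restrictions of a fixed `w ∈ L^q`, is a signed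
measure. -/
theorem exists_signedMeasure_apply_indicator (hq : 1 ≤ q) [Fact (1 ≤ ENNReal.ofReal q)]
    (L : Lp ℝ (ENNReal.ofReal q) μ →L[ℝ] ℝ) {w : α → ℝ} (hw : MemLp w (ENNReal.ofReal q) μ) :
    ∃ ν : SignedMeasure α, ∀ A (hA : MeasurableSet A),
      ν A = L ((hw.indicator hA).toLp (A.indicator w)) := by
  classical
  refine ⟨⟨fun A => if hA : MeasurableSet A then
    L ((hw.indicator hA).toLp (A.indicator w)) else 0, ?_, ?_, ?_⟩, ?_⟩
  · have : (hw.indicator MeasurableSet.empty).toLp (Set.indicator ∅ w) = 0 := by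
      simp only [Set.indicator_empty]
      exact MemLp.toLp_zero _
    simp only [MeasurableSet.empty, dite_true, this, map_zero]
  · intro A hA
    simp [hA]
  · intro f hf hdisj
    simp only [hf, MeasurableSet.iUnion hf, dite_true]
    refine L.hasSum ?_
    have hsum : ∀ s : Finset ℕ, MemLp (fun x => ∑ i ∈ s, (f i).indicator w x)
        (ENNReal.ofReal q) μ := fun s => memLp_finsetSum _ fun i _ => hw.indicator (hf i)
    have e : ∀ s : Finset ℕ, ∑ i ∈ s, (hw.indicator (hf i)).toLp ((f i).indicator w)
        = (hsum s).toLp _ := by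
      intro s
      induction s using Finset.induction_on with
      | empty => simp only [Finset.sum_empty]; exact (MemLp.toLp_zero _).symm
      | insert a s ha ih =>
        rw [Finset.sum_insert ha, ih, ← MemLp.toLp_add]
        refine MemLp.toLp_congr _ _ (Eventually.of_forall fun x => ?_)
        simp [Finset.sum_insert ha]
    have hval : ∀ (s : Finset ℕ) x, ∑ i ∈ s, (f i).indicator w x =
        (⋃ i ∈ s, f i).indicator w x := by
      intro s x
      exact (Finset.indicator_biUnion_apply s f (fun i _ j _ h => hdisj h) x).symm
    unfold HasSum
    simp_rw [e]
    refine tendsto_toLp_of_dominated hq (b := fun x => ‖w x‖) hw.norm _ _ ?_ ?_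
    · intro s
      refine Eventually.of_forall fun x => ?_
      rw [hval]
      exact norm_indicator_le_norm_self _ _
    · refine Eventually.of_forall fun x => ?_
      by_cases hx : x ∈ ⋃ i, f i
      · obtain ⟨i, hi⟩ := Set.mem_iUnion.1 hx
        refine tendsto_const_nhds.congr' ?_
        filter_upwards [eventually_ge_atTop {i}] with s hs
        rw [hval, Set.indicator_of_mem hx, Set.indicator_of_mem]
        exact Set.mem_biUnion (Finset.mem_coe.2 (hs (Finset.mem_singleton_self i))) hi
      · refine tendsto_const_nhds.congr fun s => ?_
        rw [hval, Set.indicator_of_notMem hx, Set.indicator_of_notMem]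
        exact fun h => hx (Set.iUnion₂_subset_iUnion _ _ h)
  · intro A hA
    change (if hA : MeasurableSet A then
      L ((hw.indicator hA).toLp (A.indicator w)) else 0) = _
    simp [hA]

/-- Constants need not lie in `L^q` when `μ` is infinite. This weight takes their place: it makes `A
↦ L (1_A w)` meaningful on every measurable set, and positivity allows dividing by it afterwards. -/
theorem exists_pos_memLp [SigmaFinite μ] (hq : 1 ≤ q) :
    ∃ w : α → ℝ, Measurable w ∧ (∀ x, 0 < w x) ∧ MemLp w (ENNReal.ofReal q) μ := by
  have hq0 : 0 < q := by linarith
  obtain ⟨g, hg0, hgm, hg⟩ := exists_pos_lintegral_lt_of_sigmaFinite μ one_ne_zero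
  refine ⟨fun x => (g x : ℝ) ^ (1 / q), hgm.coe_nnreal_real.pow_const _,
    fun x => Real.rpow_pos_of_pos (hg0 x) _, ?_⟩
  refine ⟨(hgm.coe_nnreal_real.pow_const _).aestronglyMeasurable, ?_⟩
  rw [eLpNorm_eq_lintegral_rpow_enorm_toReal (by simpa using hq0) ENNReal.ofReal_ne_top,
    ENNReal.toReal_ofReal hq0.le]
  refine ENNReal.rpow_lt_top_of_nonneg (by positivity) (ne_of_lt ?_)
  refine lt_of_eq_of_lt (lintegral_congr fun x => ?_) (hg.trans ENNReal.one_lt_top)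
  rw [Real.enorm_eq_ofReal (by positivity), ENNReal.ofReal_rpow_of_nonneg (by positivity) hq0.le,
    ← Real.rpow_mul (by positivity), one_div_mul_cancel hq0.ne', Real.rpow_one,
    ENNReal.ofReal_coe_nnreal]

theorem memLp_simpleFunc_mul (s : SimpleFunc α ℝ) {w : α → ℝ}
    (hw : MemLp w (ENNReal.ofReal q) μ) : MemLp (fun x => s x * w x) (ENNReal.ofReal q) μ := by
  obtain ⟨C, hC⟩ := s.exists_forall_norm_le
  refine MemLp.of_le_mul hw (s.measurable.aestronglyMeasurable.mul hw.1) (c := C) ?_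
  refine Eventually.of_forall fun x => ?_
  rw [norm_mul]
  gcongr
  exact hC x

theorem apply_toLp_simpleFunc_mul [Fact (1 ≤ ENNReal.ofReal q)]
    (L : Lp ℝ (ENNReal.ofReal q) μ →L[ℝ] ℝ) {w f₀ : α → ℝ} (hw : MemLp w (ENNReal.ofReal q) μ)
    (hf₀ : Integrable f₀ μ)
    (h : ∀ A (hA : MeasurableSet A),
      L ((hw.indicator hA).toLp (A.indicator w)) = ∫ x in A, f₀ x ∂μ) (s : SimpleFunc α ℝ) :
    L ((memLp_simpleFunc_mul s hw).toLp _) = ∫ x, s x * f₀ x ∂μ := by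
  induction s using SimpleFunc.induction with
  | @const c A hA =>
    have h1 : (memLp_simpleFunc_mul ((SimpleFunc.const α c).piecewise A hA
        (SimpleFunc.const α 0)) hw).toLp _ = c • (hw.indicator hA).toLp (A.indicator w) := by
      rw [← MemLp.toLp_const_smul]
      refine MemLp.toLp_congr _ _ (Eventually.of_forall fun x => ?_)
      by_cases hx : x ∈ A <;> simp [hx]
    rw [h1, map_smul, h A hA, smul_eq_mul, ← integral_const_mul, ← integral_indicator hA]
    refine integral_congr_ae (Eventually.of_forall fun x => ?_)
    by_cases hx : x ∈ A <;> simp [hx]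
  | @add s t hst hs ht =>
    have h1 : (memLp_simpleFunc_mul (s + t) hw).toLp _ =
        (memLp_simpleFunc_mul s hw).toLp _ + (memLp_simpleFunc_mul t hw).toLp _ := by
      rw [← MemLp.toLp_add]
      refine MemLp.toLp_congr _ _ (Eventually.of_forall fun x => ?_)
      simp [add_mul]
    have hi : ∀ s : SimpleFunc α ℝ, Integrable (fun x => s x * f₀ x) μ := fun s => by
      obtain ⟨C, hC⟩ := s.exists_forall_norm_le
      exact hf₀.bdd_mul s.measurable.aestronglyMeasurable (Eventually.of_forall hC)
    rw [h1, map_add, hs, ht, ← integral_add (hi s) (hi t)]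
    refine integral_congr_ae (Eventually.of_forall fun x => ?_)
    simp [add_mul]

/-- The key bound in the duality of `L^p` and `L^q`. -/
theorem lintegral_rpow_le_of_apply_simpleFunc (hpq : p.HolderConjugate q)
    [Fact (1 ≤ ENNReal.ofReal q)]
    (L : Lp ℝ (ENNReal.ofReal q) μ →L[ℝ] ℝ) {w f : α → ℝ} (hw : MemLp w (ENNReal.ofReal q) μ)
    (hw0 : ∀ x, 0 < w x) (hwm : Measurable w) (hf : Measurable f)
    (hfw : Integrable (fun x => f x * w x) μ)
    (h : ∀ s : SimpleFunc α ℝ,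
      L ((memLp_simpleFunc_mul s hw).toLp _) = ∫ x, s x * (f x * w x) ∂μ) :
    ∫⁻ x, ‖f x‖ₑ ^ p ∂μ ≤ ENNReal.ofReal (‖L‖ ^ p) := by
  have hp0 := hpq.pos
  have hq0 := hpq.symm.pos
  have hq1 := hpq.symm.lt
  -- Times `w` and the sign of `f`, this is the extremal function in Hölder's inequality for `f`. It
  -- is not known to give an element of `L^q`, so simple functions increasing to it are tested
  -- instead.
  set G : α → ℝ≥0∞ := fun x => ENNReal.ofReal (|f x| ^ (p - 1) / w x) with hG
  have hGm : Measurable G := (((measurable_norm.comp hf).pow_const (p - 1)).div hwm).ennreal_ofReal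
  set S : ℕ → SimpleFunc α ℝ := fun k => (SimpleFunc.eapprox G k).map ENNReal.toReal with hS
  set σ : SimpleFunc α ℝ := (SimpleFunc.const α 1).piecewise {x | 0 ≤ f x}
    (measurableSet_le measurable_const hf) (SimpleFunc.const α (-1)) with hσ
  have hσf : ∀ x, σ x * f x = |f x| := by
    intro x
    by_cases hx : 0 ≤ f x
    · simp [hσ, hx, abs_of_nonneg hx]
    · simp [hσ, hx, abs_of_neg (not_le.1 hx)]
  have hσ1 : ∀ x, |σ x| = 1 := by
    intro x
    by_cases hx : 0 ≤ f x <;> simp [hσ, hx]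
  have hS0 : ∀ k x, 0 ≤ S k x := fun k x => ENNReal.toReal_nonneg
  have hSG : ∀ k x, S k x ≤ |f x| ^ (p - 1) / w x := by
    intro k x
    have h1 : SimpleFunc.eapprox G k x ≤ G x := by
      rw [← SimpleFunc.iSup_eapprox_apply hGm x]
      exact le_iSup (fun k => SimpleFunc.eapprox G k x) k
    exact ENNReal.toReal_le_of_le_ofReal
      (div_nonneg (Real.rpow_nonneg (abs_nonneg _) _) (hw0 x).le) h1
  have hint : ∀ k, Integrable (fun x => S k x * |f x| * w x) μ := by
    intro k
    obtain ⟨C, hC⟩ := (S k).exists_forall_norm_le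
    have := hfw.norm.bdd_mul (S k).measurable.aestronglyMeasurable (Eventually.of_forall hC)
    refine this.congr (Eventually.of_forall fun x => ?_)
    simp [abs_of_pos (hw0 x), mul_assoc]
  have hX : ∀ k, ∫ x, S k x * |f x| * w x ∂μ ≤ ‖L‖ ^ p := by
    intro k
    set X := ∫ x, S k x * |f x| * w x ∂μ with hXdef
    have hX0 : 0 ≤ X := integral_nonneg fun x =>
      mul_nonneg (mul_nonneg (hS0 k x) (abs_nonneg _)) (hw0 x).le
    have h1 : X = L ((memLp_simpleFunc_mul (σ * S k) hw).toLp _) := by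
      rw [h]
      refine integral_congr_ae (Eventually.of_forall fun x => ?_)
      simp only [SimpleFunc.coe_mul, Pi.mul_apply, ← hσf]
      ring
    -- Pointwise `(S w)^q ≤ |f| S w`, because `S w ≤ |f|^{p-1}` and `(p-1)(q-1) = 1`.
    have h2 : ‖(memLp_simpleFunc_mul (σ * S k) hw).toLp _‖ ≤ X ^ (1 / q) := by
      rw [Lp.norm_toLp, eLpNorm_eq_lintegral_rpow_enorm_toReal (by simpa using hq0)
        ENNReal.ofReal_ne_top, ENNReal.toReal_ofReal hq0.le]
      refine ENNReal.toReal_le_of_le_ofReal (by positivity) ?_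
      rw [← ENNReal.ofReal_rpow_of_nonneg hX0 (by positivity), hXdef,
        ofReal_integral_eq_lintegral_ofReal (hint k) (Eventually.of_forall fun x =>
          mul_nonneg (mul_nonneg (hS0 k x) (abs_nonneg _)) (hw0 x).le)]
      refine ENNReal.rpow_le_rpow (lintegral_mono fun x => ?_) (by positivity)
      have h3 : 0 ≤ S k x * w x := mul_nonneg (hS0 k x) (hw0 x).le
      have h4 : ‖(σ * S k) x * w x‖ₑ = ENNReal.ofReal (S k x * w x) := by
        rw [← ofReal_norm]
        congr 1
        simp only [SimpleFunc.coe_mul, Pi.mul_apply, norm_mul, Real.norm_eq_abs, hσ1, one_mul,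
          abs_of_nonneg (hS0 k x), abs_of_pos (hw0 x)]
      simp only [h4]
      rw [ENNReal.ofReal_rpow_of_nonneg h3 hq0.le]
      refine ENNReal.ofReal_le_ofReal ?_
      have h5 : S k x * w x ≤ |f x| ^ (p - 1) := (le_div_iff₀ (hw0 x)).1 (hSG k x)
      have h6 : (S k x * w x) ^ (q - 1) ≤ |f x| := by
        refine (Real.rpow_le_rpow h3 h5 (by linarith)).trans_eq ?_
        rw [← Real.rpow_mul (abs_nonneg _)]
        have : (p - 1) * (q - 1) = 1 := by
          have := hpq.mul_eq_add
          linarith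
        rw [this, Real.rpow_one]
      calc (S k x * w x) ^ q = (S k x * w x) ^ (q - 1) * (S k x * w x) := by
            rw [← Real.rpow_add_one' h3 (by linarith)]
            simp
        _ ≤ |f x| * (S k x * w x) := by gcongr
        _ = _ := by ring
    have h3 : X ≤ ‖L‖ * X ^ (1 / q) := by
      calc X ≤ ‖X‖ := le_abs_self _
        _ ≤ ‖L‖ * ‖(memLp_simpleFunc_mul (σ * S k) hw).toLp _‖ := by
          rw [h1]; exact L.le_opNorm _
        _ ≤ _ := by gcongr
    -- For `X > 0` one may divide by `X^{1/q}`, leaving `X^{1/p} ≤ ‖L‖`, uniformly in `k`.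
    rcases hX0.eq_or_lt with h0 | h0
    · rw [← h0]; positivity
    have h4 : X ^ (1 / p) ≤ ‖L‖ := by
      have h5 : X ^ (1 / p) * X ^ (1 / q) = X := by
        rw [← Real.rpow_add h0]
        have := hpq.inv_add_inv_eq_one
        rw [one_div, one_div, this, Real.rpow_one]
      refine le_of_mul_le_mul_right (h5.trans_le h3) (Real.rpow_pos_of_pos h0 _)
    calc X = (X ^ (1 / p)) ^ p := by
          rw [← Real.rpow_mul hX0, one_div_mul_cancel hp0.ne', Real.rpow_one]
      _ ≤ _ := Real.rpow_le_rpow (by positivity) h4 hp0.le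
  have hsup : ∀ x, ‖f x‖ₑ ^ p =
      ⨆ k, SimpleFunc.eapprox G k x * ENNReal.ofReal (|f x| * w x) := by
    intro x
    rw [← ENNReal.iSup_mul, SimpleFunc.iSup_eapprox_apply hGm, hG, ← ENNReal.ofReal_mul
      (div_nonneg (Real.rpow_nonneg (abs_nonneg _) _) (hw0 x).le), ← ofReal_norm,
      ENNReal.ofReal_rpow_of_nonneg (norm_nonneg _) hp0.le, Real.norm_eq_abs]
    congr 1
    have := (hw0 x).ne'
    field_simp
    rw [← Real.rpow_add_one' (abs_nonneg _) (by linarith)]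
    simp
  simp_rw [hsup]
  rw [lintegral_iSup]
  · refine iSup_le fun k => ?_
    refine le_trans (le_of_eq ?_) (ENNReal.ofReal_le_ofReal (hX k))
    rw [ofReal_integral_eq_lintegral_ofReal (hint k) (Eventually.of_forall fun x =>
          mul_nonneg (mul_nonneg (hS0 k x) (abs_nonneg _)) (hw0 x).le)]
    refine lintegral_congr fun x => ?_
    rw [mul_assoc, ENNReal.ofReal_mul (hS0 k x)]
    congr 1
    exact (ENNReal.ofReal_toReal (SimpleFunc.eapprox_lt_top G k x).ne).symm
  · intro k
    exact (SimpleFunc.measurable _).mul ((measurable_norm.comp hf).mul hwm).ennreal_ofReal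
  · intro i j hij x
    exact mul_le_mul_left (SimpleFunc.monotone_eapprox G hij x) _

theorem toLp_indicator_eq_zero {r : ℝ≥0∞} {w : α → ℝ} (hw : MemLp w r μ) {A : Set α}
    (hA : MeasurableSet A) (h0 : μ A = 0) : (hw.indicator hA).toLp (A.indicator w) = 0 := by
  rw [Lp.eq_zero_iff_ae_eq_zero]
  have h1 : A.indicator w =ᵐ[μ] 0 := indicator_meas_zero h0
  exact (MemLp.coeFn_toLp _).trans h1

/-- Riesz representation: for conjugate exponents `p, q ∈ (1, ∞)` and a `σ`-finite measure, every
bounded linear functional on `L^q` is the pairing with a function in `L^p`. -/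
theorem exists_memLp_apply_eq_integral [SigmaFinite μ] (hpq : p.HolderConjugate q)
    [Fact (1 ≤ ENNReal.ofReal q)] (L : Lp ℝ (ENNReal.ofReal q) μ →L[ℝ] ℝ) :
    ∃ f : α → ℝ, MemLp f (ENNReal.ofReal p) μ ∧
      ∀ φ (hφ : MemLp φ (ENNReal.ofReal q) μ), L (hφ.toLp φ) = ∫ x, f x * φ x ∂μ := by
  have hp0 := hpq.pos
  have hq0 := hpq.symm.pos
  have hq1 := hpq.symm.lt
  have := hpq.ennreal_ofReal_holderConjugate
  obtain ⟨w, hwm, hw0, hw⟩ := exists_pos_memLp (μ := μ) hq1.le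
  obtain ⟨ν, hν⟩ := exists_signedMeasure_apply_indicator hq1.le L hw
  have hac : ν ≪ᵥ μ.toENNRealVectorMeasure := by
    refine VectorMeasure.AbsolutelyContinuous.mk fun A hA hA0 => ?_
    rw [Measure.toENNRealVectorMeasure_apply_measurable hA] at hA0
    rw [hν A hA]
    rw [toLp_indicator_eq_zero hw hA hA0, map_zero]
  have hrn := SignedMeasure.withDensityᵥ_rnDeriv_eq ν μ hac
  have hf₀ := SignedMeasure.integrable_rnDeriv ν μ
  have hf₀m := SignedMeasure.measurable_rnDeriv ν μ
  have h₀ : ∀ A (hA : MeasurableSet A),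
      L ((hw.indicator hA).toLp (A.indicator w)) = ∫ x in A, ν.rnDeriv μ x ∂μ := by
    intro A hA
    rw [← hν A hA]
    conv_lhs => rw [← hrn]
    exact withDensityᵥ_apply hf₀ hA
  set f : α → ℝ := fun x => ν.rnDeriv μ x / w x with hf
  have hfw : ∀ x, f x * w x = ν.rnDeriv μ x := fun x => div_mul_cancel₀ _ (hw0 x).ne'
  have hfm : Measurable f := hf₀m.div hwm
  have hs : ∀ s : SimpleFunc α ℝ,
      L ((memLp_simpleFunc_mul s hw).toLp _) = ∫ x, s x * (f x * w x) ∂μ := by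
    intro s
    simp_rw [hfw]
    exact apply_toLp_simpleFunc_mul L hw hf₀ h₀ s
  have hfp : MemLp f (ENNReal.ofReal p) μ := by
    refine ⟨hfm.aestronglyMeasurable, ?_⟩
    rw [eLpNorm_eq_lintegral_rpow_enorm_toReal (by simpa using hp0) ENNReal.ofReal_ne_top,
      ENNReal.toReal_ofReal hp0.le]
    refine ENNReal.rpow_lt_top_of_nonneg (by positivity) (ne_of_lt ?_)
    refine (lintegral_rpow_le_of_apply_simpleFunc hpq L hw hw0 hwm hfm ?_ hs).trans_lt
      ENNReal.ofReal_lt_top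
    simp_rw [hfw]
    exact hf₀
  refine ⟨f, hfp, fun φ hφ => ?_⟩
  set φ' := hφ.1.mk φ with hφ'
  have hφφ : φ =ᵐ[μ] φ' := hφ.1.ae_eq_mk
  have hφm : Measurable φ' := hφ.1.stronglyMeasurable_mk.measurable
  have hs'm : Measurable fun x => φ' x / w x := hφm.div hwm
  -- Approximating `φ' / w` instead of `φ'` produces functions `S k * w`, on which `L` is already
  -- known, converging to `φ'` with majorant `2 ‖φ'‖`.
  set S : ℕ → SimpleFunc α ℝ :=
    SimpleFunc.approxOn (fun x => φ' x / w x) hs'm Set.univ 0 (Set.mem_univ _) with hS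
  have hSb : ∀ k x, ‖S k x * w x‖ ≤ 2 * ‖φ' x‖ := by
    intro k x
    have h1 := SimpleFunc.norm_approxOn_zero_le hs'm (Set.mem_univ 0) x k
    calc ‖S k x * w x‖ ≤ (‖φ' x / w x‖ + ‖φ' x / w x‖) * ‖w x‖ := by
          rw [norm_mul]; gcongr
      _ = 2 * ‖φ' x‖ := by
          have := (hw0 x).ne'
          rw [norm_div]
          field_simp
          ring
  have hSt : ∀ x, Tendsto (fun k => S k x * w x) atTop (𝓝 (φ' x)) := by
    intro x
    have h1 : Tendsto (fun k => S k x) atTop (𝓝 (φ' x / w x)) :=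
      SimpleFunc.tendsto_approxOn hs'm (Set.mem_univ 0) (by simp)
    simpa [div_mul_cancel₀ _ (hw0 x).ne'] using h1.mul_const (w x)
  have hb : MemLp (fun x => 2 * ‖φ x‖) (ENNReal.ofReal q) μ := hφ.norm.const_mul 2
  have t1 : Tendsto (fun k => (memLp_simpleFunc_mul (S k) hw).toLp _) atTop (𝓝 (hφ.toLp φ)) := by
    refine tendsto_toLp_of_dominated hq1.le hb _ _ ?_ ?_
    · intro k
      filter_upwards [hφφ] with x hx
      rw [hx]
      exact hSb k x
    · filter_upwards [hφφ] with x hx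
      rw [hx]
      exact hSt x
  have t2 := (L.continuous.tendsto _).comp t1
  have t3 : Tendsto (fun k => ∫ x, S k x * (f x * w x) ∂μ) atTop (𝓝 (∫ x, f x * φ x ∂μ)) := by
    refine tendsto_integral_of_dominated_convergence (fun x => ‖f x‖ * (2 * ‖φ x‖)) ?_ ?_ ?_ ?_
    · intro k
      exact ((S k).measurable.mul (hfm.mul hwm)).aestronglyMeasurable
    · exact hfp.norm.integrable_mul hb
    · intro k
      filter_upwards [hφφ] with x hx
      have := hSb k x
      calc ‖S k x * (f x * w x)‖ = ‖f x‖ * ‖S k x * w x‖ := by simp only [norm_mul]; ring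
        _ ≤ _ := by rw [hx]; gcongr
    · filter_upwards [hφφ] with x hx
      rw [hx]
      refine ((hSt x).const_mul (f x)).congr fun k => by ring
  refine tendsto_nhds_unique t2 ?_
  refine t3.congr fun k => ?_
  exact (hs (S k)).symm

/-- Weak sequential compactness of bounded sets in `L^p`, `1 < p < ∞`: a bounded sequence has a
weak cluster point in `L^p`. -/
theorem exists_memLp_weak_cluster [SigmaFinite μ] (hpq : p.HolderConjugate q)
    {G : ℕ → α → ℝ} (hG : ∀ k, MemLp (G k) (ENNReal.ofReal p) μ) {C : ℝ}
    (hC : ∀ k, eLpNorm (G k) (ENNReal.ofReal p) μ ≤ ENNReal.ofReal C) :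
    ∃ g : α → ℝ, MemLp g (ENNReal.ofReal p) μ ∧
      ∀ (φ : α → ℝ) (c : ℝ), MemLp φ (ENNReal.ofReal q) μ →
        Tendsto (fun k => ∫ x, G k x * φ x ∂μ) atTop (𝓝 c) → ∫ x, g x * φ x ∂μ = c := by
  have hp0 := hpq.pos
  have hq0 := hpq.symm.pos
  have hq1 := hpq.symm.lt
  have := hpq.ennreal_ofReal_holderConjugate
  have : Fact (1 ≤ ENNReal.ofReal q) := ⟨by simpa using hq1.le⟩
  have : Fact (1 ≤ ENNReal.ofReal p) := ⟨by simpa using hpq.lt.le⟩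
  let B := (ContinuousLinearMap.mul ℝ ℝ).lpPairing μ (ENNReal.ofReal p) (ENNReal.ofReal q)
  let Λ : ℕ → WeakDual ℝ (Lp ℝ (ENNReal.ofReal q) μ) := fun k =>
    StrongDual.toWeakDual (B ((hG k).toLp (G k)))
  have hΛ : ∀ k φ (hφ : MemLp φ (ENNReal.ofReal q) μ),
      Λ k (hφ.toLp φ) = ∫ x, G k x * φ x ∂μ := by
    intro k φ hφ
    refine (ContinuousLinearMap.lpPairing_eq_integral _ _ _).trans ?_
    refine integral_congr_ae ?_
    filter_upwards [(hG k).coeFn_toLp, hφ.coeFn_toLp] with x h1 h2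
    simp [h1, h2]
  have hcomp := WeakDual.isCompact_closedBall (𝕜 := ℝ)
    (0 : StrongDual ℝ (Lp ℝ (ENNReal.ofReal q) μ)) (‖B‖ * max C 0)
  have hmem : ∀ k, Λ k ∈ WeakDual.toStrongDual ⁻¹'
      closedBall (0 : StrongDual ℝ (Lp ℝ (ENNReal.ofReal q) μ)) (‖B‖ * max C 0) := by
    intro k
    simp only [Set.mem_preimage, mem_closedBall, dist_zero_right]
    refine (B.le_opNorm _).trans ?_
    gcongr
    rw [Lp.norm_toLp]
    exact ENNReal.toReal_le_of_le_ofReal (le_max_right _ _)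
      ((hC k).trans (ENNReal.ofReal_le_ofReal (le_max_left _ _)))
  -- Banach–Alaoglu along a free ultrafilter: no subsequence, hence no separability of `L^q`, is
  -- needed.
  obtain ⟨L, -, hL⟩ := hcomp.ultrafilter_le_nhds ((hyperfilter ℕ).map Λ) (by
    rw [le_principal_iff]
    exact Filter.mem_map.2 (univ_mem' hmem))
  obtain ⟨g, hg, hgL⟩ := exists_memLp_apply_eq_integral hpq (WeakDual.toStrongDual L)
  refine ⟨g, hg, fun φ c hφ hc => ?_⟩
  rw [← hgL φ hφ]
  have h1 : Tendsto Λ (hyperfilter ℕ) (𝓝 L) := hL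
  have h2 : Tendsto (fun k => Λ k (hφ.toLp φ)) (hyperfilter ℕ) (𝓝 (L (hφ.toLp φ))) :=
    ((WeakDual.eval_continuous (hφ.toLp φ)).tendsto L).comp h1
  simp_rw [hΛ] at h2
  -- A free ultrafilter refines `atTop`, so it sees every genuine limit of the pairings.
  refine tendsto_nhds_unique h2 (hc.mono_left ?_)
  rw [← Nat.cofinite_eq_atTop]
  exact hyperfilter_le_cofinite

end LpDuality

/-! ### The concentrating kernels and polar coordinates. -/

section PolarKernel

/-- The probability measure on `(0, 1)` with density `κ r^{κ - 1}`; it concentrates at `0` as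
`κ ↓ 0`. -/
noncomputable def radialMeasure (κ : ℝ) : Measure ℝ :=
  (volume.restrict (Set.Ioo 0 1)).withDensity fun r => ENNReal.ofReal (κ * r ^ (κ - 1))

/-- The measure `κ |h|^{κ - n} dh` on the unit ball of `ℝⁿ`, written in polar coordinates. -/
noncomputable def polarKernel (n : ℕ) (κ : ℝ) : Measure (Eucl n) :=
  ((surfaceMeasure n).prod (radialMeasure κ)).map fun z => z.2 • (z.1 : Eucl n)

variable {κ : ℝ} {n : ℕ}

theorem measurable_radialDensity (κ : ℝ) :
    Measurable fun r : ℝ => ENNReal.ofReal (κ * r ^ (κ - 1)) :=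
  ((measurable_id.pow_const _).const_mul _).ennreal_ofReal

theorem isProbabilityMeasure_radialMeasure (hκ : 0 < κ) :
    IsProbabilityMeasure (radialMeasure κ) := by
  refine ⟨?_⟩
  rw [radialMeasure, withDensity_apply _ MeasurableSet.univ, Measure.restrict_univ,
    Measure.restrict_congr_set Ioo_ae_eq_Ioc]
  have hi : IntervalIntegrable (fun r : ℝ => κ * r ^ (κ - 1)) volume 0 1 :=
    (intervalIntegral.intervalIntegrable_rpow' (by linarith)).const_mul _
  rw [← ofReal_integral_eq_lintegral_ofReal
    ((intervalIntegrable_iff_integrableOn_Ioc_of_le zero_le_one).1 hi),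
    ← intervalIntegral.integral_of_le zero_le_one, intervalIntegral.integral_const_mul,
    integral_rpow (Or.inl (by linarith))]
  · simp [Real.zero_rpow hκ.ne', hκ.ne']
  · filter_upwards [ae_restrict_mem measurableSet_Ioc] with r hr
    exact mul_nonneg hκ.le (Real.rpow_nonneg hr.1.le _)

/-- For `δ ≤ r < 1` the density satisfies `κ r^{κ-1} ≤ κ r⁻¹ ≤ κ / δ`; this is the concentration at
`0`. -/
theorem radialMeasure_Ici_le (hκ : 0 < κ) {δ : ℝ} (hδ : 0 < δ) :
    radialMeasure κ (Set.Ici δ) ≤ ENNReal.ofReal (κ / δ) := by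
  rw [radialMeasure, withDensity_apply _ measurableSet_Ici]
  calc ∫⁻ r in Set.Ici δ, ENNReal.ofReal (κ * r ^ (κ - 1)) ∂volume.restrict (Set.Ioo 0 1)
      ≤ ∫⁻ r in Set.Ici δ, ENNReal.ofReal (κ / δ) ∂volume.restrict (Set.Ioo 0 1) := by
        refine lintegral_mono_ae ?_
        filter_upwards [ae_restrict_mem measurableSet_Ici,
          ae_restrict_of_ae (ae_restrict_mem measurableSet_Ioo)] with r h1 h2
        refine ENNReal.ofReal_le_ofReal ?_
        rw [div_eq_mul_inv]
        gcongr
        calc r ^ (κ - 1) ≤ r ^ (-1 : ℝ) :=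
              Real.rpow_le_rpow_of_exponent_ge h2.1 h2.2.le (by linarith)
          _ = r⁻¹ := Real.rpow_neg_one r
          _ ≤ δ⁻¹ := inv_anti₀ hδ h1
    _ ≤ ENNReal.ofReal (κ / δ) * 1 := by
        rw [setLIntegral_const]
        gcongr
        refine (measure_mono (Set.subset_univ _)).trans ?_
        simp
    _ = _ := mul_one _

theorem tendsto_radialMeasure_Ici {δ : ℝ} (hδ : 0 < δ) :
    Tendsto (fun κ => radialMeasure κ (Set.Ici δ)) (𝓝[>] 0) (𝓝 0) := by
  have h1 : Tendsto (fun κ : ℝ => ENNReal.ofReal (κ / δ)) (𝓝[>] 0) (𝓝 0) := by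
    have h2 : Tendsto (fun κ : ℝ => ENNReal.ofReal (κ / δ)) (𝓝 0) (𝓝 (ENNReal.ofReal (0 / δ))) :=
      (ENNReal.continuous_ofReal.comp (continuous_id.div_const δ)).tendsto 0
    simpa using h2.mono_left nhdsWithin_le_nhds
  refine tendsto_of_tendsto_of_tendsto_of_le_of_le' tendsto_const_nhds h1
    (Eventually.of_forall fun _ => zero_le) ?_
  filter_upwards [self_mem_nhdsWithin] with κ hκ
  exact radialMeasure_Ici_le hκ hδ

theorem radialMeasure_absolutelyContinuous (κ : ℝ) :
    radialMeasure κ ≪ volume.restrict (Set.Ioo 0 1) :=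
  withDensity_absolutelyContinuous _ _

theorem absolutelyContinuous_radialMeasure (hκ : 0 < κ) :
    volume.restrict (Set.Ioo 0 1) ≪ radialMeasure κ := by
  refine withDensity_absolutelyContinuous' (measurable_radialDensity κ).aemeasurable ?_
  filter_upwards [ae_restrict_mem measurableSet_Ioo] with r hr
  simpa using mul_pos hκ (Real.rpow_pos_of_pos hr.1 _)

theorem measurable_polarMap : Measurable fun z : USphere n × ℝ => z.2 • (z.1 : Eucl n) :=
  measurable_snd.smul (measurable_subtype_coe.comp measurable_fst)

theorem isFiniteMeasure_polarKernel (hκ : 0 < κ) : IsFiniteMeasure (polarKernel n κ) := by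
  have := isProbabilityMeasure_radialMeasure hκ
  exact Measure.isFiniteMeasure_map _ _

theorem polarKernel_univ (hκ : 0 < κ) :
    polarKernel n κ Set.univ = surfaceMeasure n Set.univ := by
  have := isProbabilityMeasure_radialMeasure hκ
  rw [polarKernel, Measure.map_apply measurable_polarMap MeasurableSet.univ, Set.preimage_univ,
    ← Set.univ_prod_univ, Measure.prod_prod, measure_univ (μ := radialMeasure κ), mul_one]

theorem lintegral_polarKernel (hκ : 0 < κ) {f : Eucl n → ℝ≥0∞} (hf : Measurable f) :
    ∫⁻ h, f h ∂(polarKernel n κ) =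
      ∫⁻ ω : USphere n, ∫⁻ r, f (r • (ω : Eucl n)) ∂(radialMeasure κ) ∂(surfaceMeasure n) := by
  have := isProbabilityMeasure_radialMeasure hκ
  rw [polarKernel, lintegral_map hf measurable_polarMap, lintegral_prod]
  exact (hf.comp measurable_polarMap).aemeasurable

/-- Integration in polar coordinates. -/
theorem lintegral_eq_lintegral_polar (hn : 1 ≤ n) {f : Eucl n → ℝ≥0∞} (hf : Measurable f) :
    ∫⁻ h, f h = ∫⁻ ω : USphere n, (∫⁻ r in Set.Ioi (0 : ℝ), ENNReal.ofReal (r ^ (n - 1)) *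
      f (r • (ω : Eucl n))) ∂(surfaceMeasure n) := by
  have hfin : Module.finrank ℝ (Eucl n) = n := finrank_euclideanSpace_fin
  have : Nontrivial (Eucl n) := Module.nontrivial_of_finrank_pos (R := ℝ) (by omega)
  have hmp := (volume : Measure (Eucl n)).measurePreserving_homeomorphUnitSphereProd
  have h1 : ∫⁻ h, f h = ∫⁻ h : ({0}ᶜ : Set (Eucl n)), f h
      ∂((volume : Measure (Eucl n)).comap (↑)) := by
    rw [lintegral_subtype_comap (measurableSet_singleton _).compl, restrict_compl_singleton]
  have h2 := hmp.lintegral_comp_emb (homeomorphUnitSphereProd (Eucl n)).measurableEmbedding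
    (fun z => f ((z.2 : ℝ) • (z.1 : Eucl n)))
  rw [h1]
  have h3 : ∀ h : ({0}ᶜ : Set (Eucl n)),
      (((homeomorphUnitSphereProd (Eucl n) h).2 : ℝ) •
        ((homeomorphUnitSphereProd (Eucl n) h).1 : Eucl n)) = h := by
    intro h
    exact congrArg Subtype.val ((homeomorphUnitSphereProd (Eucl n)).symm_apply_apply h)
  simp only [h3] at h2
  rw [h2, hfin, lintegral_prod]
  · refine lintegral_congr fun ω => ?_
    rw [Measure.volumeIoiPow, lintegral_withDensity_eq_lintegral_mul]
    · rw [← lintegral_subtype_comap measurableSet_Ioi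
        (fun r : ℝ => ENNReal.ofReal (r ^ (n - 1)) * f (r • (ω : Eucl n)))]
      rfl
    · exact (measurable_subtype_coe.pow_const _).ennreal_ofReal
    · have hω : Measurable fun r : Set.Ioi (0 : ℝ) => (r : ℝ) • (ω : Eucl n) :=
        measurable_subtype_coe.smul_const _
      exact hf.comp hω
  · refine Measurable.aemeasurable ?_
    exact hf.comp ((measurable_subtype_coe.comp measurable_snd).smul
      (measurable_subtype_coe.comp measurable_fst))

theorem norm_smul_sphere {r : ℝ} (hr : 0 ≤ r) (ω : USphere n) : ‖r • (ω : Eucl n)‖ = r := by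
  rw [norm_smul, norm_eq_of_mem_sphere, mul_one, Real.norm_of_nonneg hr]

/-- The Jacobian `r^{n-1}` turns `r^{κ-n}` into the radial density `r^{κ-1}`. The energy is matched
with this form, radial limits with the polar one. -/
theorem polarKernel_eq_withDensity (hn : 1 ≤ n) (hκ : 0 < κ) :
    polarKernel n κ = (volume.restrict (ball (0 : Eucl n) 1)).withDensity
      fun h => ENNReal.ofReal (κ * ‖h‖ ^ (κ - n)) := by
  have hm : Measurable fun h : Eucl n => ENNReal.ofReal (κ * ‖h‖ ^ (κ - n)) :=
    ((measurable_norm.pow_const _).const_mul _).ennreal_ofReal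
  refine Measure.ext_of_lintegral _ fun f hf => ?_
  rw [lintegral_polarKernel hκ hf, lintegral_withDensity_eq_lintegral_mul _ hm hf,
    ← lintegral_indicator measurableSet_ball,
    lintegral_eq_lintegral_polar hn ((hm.mul hf).indicator measurableSet_ball)]
  refine lintegral_congr fun ω => ?_
  have hfω : Measurable fun r : ℝ => f (r • (ω : Eucl n)) := hf.comp (measurable_id.smul_const _)
  rw [radialMeasure, lintegral_withDensity_eq_lintegral_mul _ (measurable_radialDensity κ) hfω,
    ← lintegral_indicator measurableSet_Ioo, ← lintegral_indicator measurableSet_Ioi]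
  refine lintegral_congr fun r => ?_
  by_cases h0 : 0 < r
  · by_cases h1 : r < 1
    · rw [Set.indicator_of_mem (show r ∈ Set.Ioo 0 1 from ⟨h0, h1⟩),
        Set.indicator_of_mem (show r ∈ Set.Ioi 0 from h0), Set.indicator_of_mem]
      · simp only [Pi.mul_apply]
        rw [norm_smul_sphere h0.le, ← mul_assoc, ← ENNReal.ofReal_mul (by positivity)]
        congr 2
        rw [← Real.rpow_natCast, Nat.cast_sub hn, mul_left_comm, ← Real.rpow_add h0]
        congr 2
        push_cast
        ring
      · simpa [norm_smul_sphere h0.le] using h1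
    · rw [Set.indicator_of_notMem (by simp [h1]),
        Set.indicator_of_mem (show r ∈ Set.Ioi 0 from h0), Set.indicator_of_notMem, mul_zero]
      simpa [norm_smul_sphere h0.le] using h1
  · rw [Set.indicator_of_notMem (by simp [h0]), Set.indicator_of_notMem (by simpa using h0)]

theorem polarKernel_absolutelyContinuous (hn : 1 ≤ n) (hκ : 0 < κ) :
    polarKernel n κ ≪ volume := by
  rw [polarKernel_eq_withDensity hn hκ]
  exact (withDensity_absolutelyContinuous _ _).trans Measure.restrict_le_self.absolutelyContinuous

/-- Any fixed `κ` would serve; `κ = 1` is used. The kernel is absolutely continuous, and its radial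
factor has the same null sets as Lebesgue measure on `(0, 1)`. -/
theorem ae_polar_of_ae (hn : 1 ≤ n) {P : Eucl n → Prop} (h : ∀ᵐ x, P x) :
    ∀ᵐ ω : USphere n ∂(surfaceMeasure n), ∀ᵐ r ∂(volume.restrict (Set.Ioo (0 : ℝ) 1)),
      P (r • (ω : Eucl n)) := by
  have := isProbabilityMeasure_radialMeasure one_pos
  have h1 := (polarKernel_absolutelyContinuous hn one_pos).ae_le h
  have h2 := Measure.ae_ae_of_ae_prod (ae_of_ae_map measurable_polarMap.aemeasurable h1)
  filter_upwards [h2] with ω hω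
  exact (absolutelyContinuous_radialMeasure one_pos).ae_le hω

/-- A bounded function vanishing at the origin has small integral against `polarKernel n κ`. -/
theorem tendsto_lintegral_polarKernel_zero {Φ : Eucl n → ℝ≥0∞} {B : ℝ≥0∞} (hB : B ≠ ∞)
    (hΦB : ∀ h, Φ h ≤ B) (hΦ : Tendsto Φ (𝓝 0) (𝓝 0)) :
    Tendsto (fun κ => ∫⁻ h, Φ h ∂(polarKernel n κ)) (𝓝[>] 0) (𝓝 0) := by
  have hS : surfaceMeasure n Set.univ ≠ ∞ := measure_ne_top _ _
  rw [ENNReal.tendsto_nhds_zero]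
  intro ε hε
  obtain ⟨η, hη, hηε⟩ : ∃ η : ℝ≥0∞, 0 < η ∧ η * surfaceMeasure n Set.univ ≤ ε / 2 := by
    refine ⟨ε / 2 / (surfaceMeasure n Set.univ + 1), ?_, ?_⟩
    · exact ENNReal.div_pos (by simpa using hε.ne') (ENNReal.add_ne_top.2 ⟨hS, ENNReal.one_ne_top⟩)
    · calc ε / 2 / (surfaceMeasure n Set.univ + 1) * surfaceMeasure n Set.univ
          ≤ ε / 2 / (surfaceMeasure n Set.univ + 1) * (surfaceMeasure n Set.univ + 1) := by
            gcongr; exact le_self_add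
        _ ≤ _ := (ENNReal.div_mul_cancel (by simp) (ENNReal.add_ne_top.2 ⟨hS, ENNReal.one_ne_top⟩)).le
  obtain ⟨δ, hδ, hδη⟩ := Metric.eventually_nhds_iff_ball.1 (ENNReal.tendsto_nhds_zero.1 hΦ η hη)
  have hfar : Tendsto (fun κ => B * (surfaceMeasure n Set.univ * radialMeasure κ (Set.Ici δ)))
      (𝓝[>] 0) (𝓝 0) := by
    have := ENNReal.Tendsto.const_mul (a := B) (ENNReal.Tendsto.const_mul
      (a := surfaceMeasure n Set.univ) (tendsto_radialMeasure_Ici hδ) (Or.inr hS)) (Or.inr hB)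
    simpa using this
  have hε2 : (0 : ℝ≥0∞) < ε / 2 := by simpa using hε.ne'
  filter_upwards [ENNReal.tendsto_nhds_zero.1 hfar _ hε2, self_mem_nhdsWithin] with κ hκ hκ0
  have hκ0' : 0 < κ := hκ0
  have := isProbabilityMeasure_radialMeasure hκ0'
  have hKfar : polarKernel n κ (ball 0 δ)ᶜ ≤
      surfaceMeasure n Set.univ * radialMeasure κ (Set.Ici δ) := by
    rw [polarKernel, Measure.map_apply measurable_polarMap measurableSet_ball.compl]
    have hpos : ∀ᵐ r ∂(radialMeasure κ), 0 < r := by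
      refine (radialMeasure_absolutelyContinuous κ).ae_le ?_
      filter_upwards [ae_restrict_mem measurableSet_Ioo] with r hr using hr.1
    have hpos' : ∀ᵐ z ∂((surfaceMeasure n).prod (radialMeasure κ)), 0 < z.2 :=
      Measure.quasiMeasurePreserving_snd.ae hpos
    rw [← Measure.prod_prod]
    refine measure_mono_ae ?_
    filter_upwards [hpos'] with z hz hz2
    refine ⟨trivial, ?_⟩
    have h3 : z.2 • (z.1 : Eucl n) ∉ ball 0 δ := hz2
    simpa [norm_smul_sphere hz.le] using h3
  calc ∫⁻ h, Φ h ∂(polarKernel n κ)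
      = ∫⁻ h in ball 0 δ, Φ h ∂(polarKernel n κ) + ∫⁻ h in (ball 0 δ)ᶜ, Φ h ∂(polarKernel n κ) :=
        (lintegral_add_compl _ measurableSet_ball).symm
    _ ≤ η * polarKernel n κ (ball 0 δ) + B * polarKernel n κ (ball 0 δ)ᶜ := by
        rw [← setLIntegral_const, ← setLIntegral_const]
        gcongr ?_ + ?_
        · exact setLIntegral_mono' measurableSet_ball fun h hh => hδη h hh
        · exact lintegral_mono fun h => hΦB h
    _ ≤ ε / 2 + ε / 2 := by
        gcongr
        · refine le_trans ?_ hηε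
          gcongr
          rw [← polarKernel_univ hκ0']
          exact measure_mono (Set.subset_univ _)
        · exact le_trans (by gcongr) hκ
    _ = ε := ENNReal.add_halves ε

/-- The measures are probabilities concentrating at `0`: `|f - c|` is small for `r < δ`, and at most
`M + |c|` on the remaining set of vanishing mass. Only an essential limit at `0` is required, as
kernels are known almost everywhere. -/
theorem tendsto_integral_radialMeasure {f : ℝ → ℝ} (hf : Measurable f) {M : ℝ}
    (hM : ∀ r, |f r| ≤ M) {c : ℝ} (hc : ∀ η > 0, ∃ δ > 0,
      ∀ᵐ r ∂(volume.restrict (Set.Ioo (0 : ℝ) 1)), r < δ → |f r - c| ≤ η) :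
    Tendsto (fun κ => ∫ r, f r ∂(radialMeasure κ)) (𝓝[>] 0) (𝓝 c) := by
  rw [Metric.tendsto_nhds]
  intro ε hε
  have hM0 : 0 ≤ M := (abs_nonneg _).trans (hM 0)
  obtain ⟨δ, hδ, hδc⟩ := hc (ε / 2) (by positivity)
  have hfar := (ENNReal.tendsto_toReal ENNReal.zero_ne_top).comp (tendsto_radialMeasure_Ici hδ)
  have hfar2 := hfar.const_mul (M + |c|)
  simp only [ENNReal.toReal_zero, mul_zero] at hfar2
  filter_upwards [hfar2.eventually (gt_mem_nhds (half_pos hε)), self_mem_nhdsWithin] with κ h1 hκ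
  have hκ0 : 0 < κ := hκ
  have := isProbabilityMeasure_radialMeasure hκ0
  have hint : Integrable f (radialMeasure κ) :=
    Integrable.of_bound hf.aestronglyMeasurable M (Eventually.of_forall hM)
  have hbound : ∀ᵐ r ∂(radialMeasure κ),
      |f r - c| ≤ ε / 2 + (Set.Ici δ).indicator (fun _ => M + |c|) r := by
    filter_upwards [(radialMeasure_absolutelyContinuous κ).ae_le hδc] with r hr
    by_cases h : r < δ
    · simpa [h] using hr h
    · rw [Set.indicator_of_mem (by simpa using h)]
      have := abs_sub (f r) c
      have := hM r
      linarith
  have hint2 : Integrable ((Set.Ici δ).indicator fun _ => M + |c|) (radialMeasure κ) :=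
    (integrable_const _).indicator measurableSet_Ici
  rw [Real.dist_eq]
  calc |∫ r, f r ∂(radialMeasure κ) - c| = |∫ r, (f r - c) ∂(radialMeasure κ)| := by
        rw [integral_sub hint (integrable_const _)]; simp
    _ ≤ ∫ r, |f r - c| ∂(radialMeasure κ) := abs_integral_le_integral_abs
    _ ≤ ∫ r, (ε / 2 + (Set.Ici δ).indicator (fun _ => M + |c|) r) ∂(radialMeasure κ) :=
        integral_mono_ae (hint.sub (integrable_const _)).abs
          ((integrable_const _).add hint2) hbound
    _ = ε / 2 + (M + |c|) * (radialMeasure κ (Set.Ici δ)).toReal := by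
        rw [integral_add (integrable_const _) hint2, integral_indicator measurableSet_Ici]
        simp [Measure.real, mul_comm]
    _ < ε := by
        simp only [Function.comp_apply] at h1
        linarith

/-- Radial limits and integration against `polarKernel n κ`: if `f` is bounded and `f (r ω) → b ω`
as `r ↓ 0`, then `∫ f` tends to the integral of `b` over the sphere. -/
theorem tendsto_integral_polarKernel {f : Eucl n → ℝ} (hf : Measurable f) {M : ℝ}
    (hM : ∀ h, |f h| ≤ M) {b : USphere n → ℝ} (hb : ∀ᵐ ω : USphere n ∂(surfaceMeasure n), ∀ η > 0, ∃ δ > 0,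
      ∀ᵐ r ∂(volume.restrict (Set.Ioo (0 : ℝ) 1)), r < δ → |f (r • (ω : Eucl n)) - b ω| ≤ η) :
    Tendsto (fun κ => ∫ h, f h ∂(polarKernel n κ)) (𝓝[>] 0) (𝓝 (∫ ω, b ω ∂(surfaceMeasure n))) := by
  have e : ∀ κ > 0, ∫ h, f h ∂(polarKernel n κ) =
      ∫ ω : USphere n, ∫ r, f (r • (ω : Eucl n)) ∂(radialMeasure κ) ∂(surfaceMeasure n) := by
    intro κ hκ
    have := isProbabilityMeasure_radialMeasure hκ
    rw [polarKernel, integral_map measurable_polarMap.aemeasurable hf.aestronglyMeasurable,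
      integral_prod]
    exact Integrable.of_bound (hf.comp measurable_polarMap).aestronglyMeasurable M
      (Eventually.of_forall fun z => hM _)
  have h1 : Tendsto (fun κ => ∫ ω : USphere n, ∫ r, f (r • (ω : Eucl n)) ∂(radialMeasure κ) ∂(surfaceMeasure n))
      (𝓝[>] 0) (𝓝 (∫ ω, b ω ∂(surfaceMeasure n))) := by
    refine tendsto_integral_filter_of_dominated_convergence (fun _ => M) ?_ ?_
      (integrable_const _) ?_
    · filter_upwards [self_mem_nhdsWithin] with κ hκ
      have := isProbabilityMeasure_radialMeasure hκ
      exact (hf.comp measurable_polarMap).aestronglyMeasurable.integral_prod_right'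
        (μ := surfaceMeasure n) (ν := radialMeasure κ)
    · filter_upwards [self_mem_nhdsWithin] with κ hκ
      have := isProbabilityMeasure_radialMeasure hκ
      refine Eventually.of_forall fun ω => ?_
      have := norm_integral_le_of_norm_le_const (μ := radialMeasure κ)
        (f := fun r => f (r • (ω : Eucl n))) (Eventually.of_forall fun r => hM _)
      simpa using this
    · filter_upwards [hb] with ω hω
      exact tendsto_integral_radialMeasure (hf.comp (measurable_id.smul_const _))
        (fun r => hM _) hω
  refine h1.congr' ?_
  filter_upwards [self_mem_nhdsWithin] with κ hκ
  exact (e κ hκ).symm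

end PolarKernel

/-! ### Translations in `L^p` and differences of Sobolev functions. -/

section Translation

variable {n : ℕ} {p : ℝ}

/-- Jensen's inequality for integrals depending on a parameter. -/
theorem lintegral_enorm_integral_rpow_le {α β : Type*} [MeasurableSpace α] [MeasurableSpace β]
    {μ : Measure α} {ν : Measure β} [SFinite μ] [IsFiniteMeasure ν] (hp : 1 ≤ p) {G : α × β → ℝ}
    (hG : Measurable G) :
    ∫⁻ x, ‖∫ t, G (x, t) ∂ν‖ₑ ^ p ∂μ ≤
      ν Set.univ ^ (p - 1) * ∫⁻ t, ∫⁻ x, ‖G (x, t)‖ₑ ^ p ∂μ ∂ν := by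
  have hp0 : 0 < p := by linarith
  rw [lintegral_lintegral_swap ((hG.comp measurable_swap).enorm.pow_const p).aemeasurable,
    ← lintegral_const_mul' _ _ (ENNReal.rpow_ne_top_of_nonneg (by linarith) (measure_ne_top _ _))]
  refine lintegral_mono fun x => ?_
  have h1 := eLpNorm'_le_eLpNorm'_mul_rpow_measure_univ (μ := ν) (f := fun t => G (x, t))
    one_pos hp (hG.comp measurable_prodMk_left).aestronglyMeasurable
  simp only [eLpNorm'_eq_lintegral_enorm, ENNReal.rpow_one, div_one] at h1
  calc ‖∫ t, G (x, t) ∂ν‖ₑ ^ p ≤ (∫⁻ t, ‖G (x, t)‖ₑ ∂ν) ^ p := by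
        gcongr
        exact enorm_integral_le_lintegral_enorm _
    _ ≤ ((∫⁻ t, ‖G (x, t)‖ₑ ^ p ∂ν) ^ (1 / p) * ν Set.univ ^ (1 - 1 / p)) ^ p := by gcongr
    _ = _ := by
        rw [ENNReal.mul_rpow_of_nonneg _ _ hp0.le, ← ENNReal.rpow_mul, ← ENNReal.rpow_mul,
          one_div_mul_cancel hp0.ne', ENNReal.rpow_one, mul_comm]
        congr 2
        field_simp

theorem eLpNorm_rpow_eq_lintegral {α F : Type*} [MeasurableSpace α] [NormedAddCommGroup F]
    {μ : Measure α} (hp : 0 < p) (f : α → F) :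
    eLpNorm f (ENNReal.ofReal p) μ ^ p = ∫⁻ x, ‖f x‖ₑ ^ p ∂μ := by
  rw [eLpNorm_eq_lintegral_rpow_enorm_toReal (by simpa using hp) ENNReal.ofReal_ne_top,
    ENNReal.toReal_ofReal hp.le, ← ENNReal.rpow_mul, one_div_mul_cancel hp.ne', ENNReal.rpow_one]

/-- Continuity of translations in `L^p`. -/
theorem tendsto_eLpNorm_translate_sub {F : Type*} [NormedAddCommGroup F] {r : ℝ≥0∞} (hr : 1 ≤ r)
    (hr' : r ≠ ∞) {g : Eucl n → F} (hg : MemLp g r) :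
    Tendsto (fun h => eLpNorm (fun x => g (x - h) - g x) r) (𝓝 0) (𝓝 0) := by
  have : Fact (1 ≤ r) := ⟨hr⟩
  have : Fact (r ≠ ∞) := ⟨hr'⟩
  -- The additive action of `ℝⁿ` on `L^r` by translation of the argument is continuous for finite
  -- `r`; acting by `-h` yields `g (x - h)`.
  have hc : Continuous fun h : Eucl n => DomAddAct.mk (-h) +ᵥ hg.toLp g :=
    (DomAddAct.continuous_mk.comp continuous_neg).vadd continuous_const
  have h1 : Tendsto (fun h : Eucl n => edist (DomAddAct.mk (-h) +ᵥ hg.toLp g) (hg.toLp g)) (𝓝 0)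
      (𝓝 0) := by
    have h2 := (hc.edist (continuous_const (y := hg.toLp g))).tendsto (0 : Eucl n)
    simpa using h2
  refine h1.congr fun h => ?_
  rw [DomAddAct.mk_vadd_toLp, Lp.edist_toLp_toLp]
  refine eLpNorm_congr_ae (Eventually.of_forall fun x => ?_)
  simp [sub_eq_neg_add]

theorem measurePreserving_sub_smul (ν : Measure ℝ) [SFinite ν] (h : Eucl n) :
    MeasurePreserving (fun z : Eucl n × ℝ => (z.1 - z.2 • h, z.2)) (volume.prod ν)
      (volume.prod ν) := by
  have h1 : MeasurePreserving (fun z : ℝ × Eucl n => (id z.1, z.2 - z.1 • h)) (ν.prod volume)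
      (ν.prod volume) := by
    refine (MeasurePreserving.id ν).skew_product (g := fun t x => x - t • h)
      (by fun_prop) ?_
    exact Eventually.of_forall fun t => (measurePreserving_sub_right volume (t • h)).map_eq
  exact (Measure.measurePreserving_swap.comp h1).comp Measure.measurePreserving_swap

/-- The hypothesis of Fubini on segments. For `t ∈ (0, 1]` and `supp ψ` in the ball of radius `R`,
the integrand lives on `‖x‖ ≤ R + ‖h‖`, where `w` is integrable. -/
theorem integrable_comp_add_smul_mul {w ψ : Eucl n → ℝ} (hw : LocallyIntegrable w)
    (hwm : Measurable w) (hψ : Continuous ψ) (hψc : HasCompactSupport ψ) (h : Eucl n) :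
    Integrable (fun z : Eucl n × ℝ => ψ (z.1 + z.2 • h) * w z.1)
      (volume.prod (volume.restrict (Set.Ioc 0 1))) := by
  obtain ⟨C, hC⟩ := hψc.exists_bound_of_continuous hψ
  obtain ⟨R, hR⟩ := hψc.isCompact.isBounded.subset_closedBall 0
  set K : Set (Eucl n) := closedBall 0 (R + ‖h‖) with hK
  have hwK : Integrable (K.indicator w) :=
    (hw.integrableOn_isCompact (isCompact_closedBall _ _)).integrable_indicator
      measurableSet_closedBall
  have h1 : Integrable (fun z : Eucl n × ℝ => K.indicator w z.1 * C)
      (volume.prod (volume.restrict (Set.Ioc 0 1))) :=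
    hwK.mul_prod (integrable_const C)
  refine h1.mono ?_ ?_
  · refine Measurable.aestronglyMeasurable ?_
    exact (hψ.measurable.comp (by fun_prop)).mul (hwm.comp measurable_fst)
  · have h2 : ∀ᵐ z ∂((volume : Measure (Eucl n)).prod (volume.restrict (Set.Ioc (0 : ℝ) 1))),
        z.2 ∈ Set.Ioc (0 : ℝ) 1 :=
      Measure.quasiMeasurePreserving_snd.ae (ae_restrict_mem measurableSet_Ioc)
    filter_upwards [h2] with z hz
    by_cases hzK : z.1 ∈ K
    · rw [Set.indicator_of_mem hzK, norm_mul, norm_mul, mul_comm]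
      gcongr
      exact (hC _).trans (le_abs_self C)
    · have h3 : ψ (z.1 + z.2 • h) = 0 := by
        by_contra h0
        refine hzK ?_
        have h4 := hR (subset_tsupport _ h0)
        rw [mem_closedBall_zero_iff] at h4 ⊢
        calc ‖z.1‖ = ‖(z.1 + z.2 • h) - z.2 • h‖ := by simp
          _ ≤ ‖z.1 + z.2 • h‖ + ‖z.2 • h‖ := norm_sub_le _ _
          _ ≤ R + 1 * ‖h‖ := by
            rw [norm_smul, Real.norm_of_nonneg hz.1.le]
            gcongr
            exact hz.2
          _ = _ := by rw [one_mul]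
      simpa [h3] using by positivity

theorem integrable_mul_comp_sub_smul {w ψ : Eucl n → ℝ} (hw : LocallyIntegrable w)
    (hwm : Measurable w) (hψ : Continuous ψ) (hψc : HasCompactSupport ψ) (h : Eucl n) :
    Integrable (fun z : Eucl n × ℝ => ψ z.1 * w (z.1 - z.2 • h))
      (volume.prod (volume.restrict (Set.Ioc 0 1))) := by
  have h1 := (measurePreserving_sub_smul (volume.restrict (Set.Ioc 0 1)) h).integrable_comp_of_integrable
    (integrable_comp_add_smul_mul hw hwm hψ hψc h)
  refine h1.congr (Eventually.of_forall fun z => ?_)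
  simp

theorem fderiv_apply_continuous_hasCompactSupport {φ : Eucl n → ℝ}
    (hφ : ContDiff ℝ ((⊤ : ℕ∞) : WithTop ℕ∞) φ) (hφc : HasCompactSupport φ) (v : Eucl n) :
    Continuous (fun x => fderiv ℝ φ x v) ∧ HasCompactSupport (fun x => fderiv ℝ φ x v) :=
  ⟨(hφ.continuous_fderiv (by simp)).clm_apply continuous_const, hφc.fderiv_apply ℝ v⟩

/-- Discrete integration by parts, from translation invariance of the measure. -/
theorem integral_mul_sub_translate {u φ : Eucl n → ℝ} (hu : LocallyIntegrable u)
    (hφ : Continuous φ) (hφc : HasCompactSupport φ) (h : Eucl n) :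
    ∫ x, φ x * (u x - u (x - h)) = ∫ x, u x * (φ x - φ (x + h)) := by
  have i1 : Integrable fun x => φ x * u x :=
    hu.integrable_smul_left_of_hasCompactSupport hφ hφc
  have i2 : Integrable fun x => φ (x + h) * u x :=
    hu.integrable_smul_left_of_hasCompactSupport (hφ.comp (continuous_add_const h))
      (hφc.comp_homeomorph (Homeomorph.addRight h))
  have i3 : Integrable fun x => φ x * u (x - h) := by
    have := i2.comp_sub_right h
    simpa using this
  have e1 : ∫ x, φ x * u (x - h) = ∫ x, φ (x + h) * u x := by
    rw [← integral_sub_right_eq_self (fun x => φ (x + h) * u x) h]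
    simp
  calc ∫ x, φ x * (u x - u (x - h)) = ∫ x, (φ x * u x - φ x * u (x - h)) := by
        simp_rw [mul_sub]
    _ = (∫ x, φ x * u x) - ∫ x, φ (x + h) * u x := by rw [integral_sub i1 i3, e1]
    _ = ∫ x, (φ x * u x - φ (x + h) * u x) := (integral_sub i1 i2).symm
    _ = _ := by congr 1; ext x; ring

theorem sub_translate_eq_integral_fderiv {φ : Eucl n → ℝ}
    (hφ : ContDiff ℝ ((⊤ : ℕ∞) : WithTop ℕ∞) φ) (x h : Eucl n) :
    φ (x + h) - φ x = ∫ t in Set.Ioc (0 : ℝ) 1, fderiv ℝ φ (x + t • h) h := by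
  have hd : ∀ t : ℝ, HasDerivAt (fun t : ℝ => φ (x + t • h)) (fderiv ℝ φ (x + t • h) h) t := by
    intro t
    have h1 : HasDerivAt (fun t : ℝ => x + t • h) h t := by
      simpa using ((hasDerivAt_id t).smul_const h).const_add x
    exact ((hφ.differentiable (by simp)) _).hasFDerivAt.comp_hasDerivAt t h1
  have hc : Continuous fun t : ℝ => fderiv ℝ φ (x + t • h) h :=
    ((hφ.continuous_fderiv (by simp)).comp (by fun_prop)).clm_apply continuous_const
  have := intervalIntegral.integral_eq_sub_of_hasDerivAt (fun t _ => hd t)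
    (hc.intervalIntegrable 0 1)
  rw [← intervalIntegral.integral_of_le zero_le_one, this]
  simp

/-- The fundamental theorem of calculus along segments, for Sobolev functions. -/
theorem IsWeakGradient.sub_translate_ae_eq (hp : 1 ≤ p) {u : Eucl n → ℝ} {g : Eucl n → Eucl n}
    (hug : IsWeakGradient u g) (hum : Measurable u) (hgm : Measurable g)
    (hu : MemLp u (ENNReal.ofReal p)) (hg : MemLp g (ENNReal.ofReal p)) (h : Eucl n) :
    ∀ᵐ x, u x - u (x - h) = ∫ t in Set.Ioc (0 : ℝ) 1, inner ℝ (g (x - t • h)) h := by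
  have hp' : 1 ≤ ENNReal.ofReal p := by simpa using hp
  have hp0 : 0 < p := by linarith
  set w : Eucl n → ℝ := fun x => inner ℝ (g x) h with hw
  have hwm : Measurable w := hgm.inner measurable_const
  have hwp : MemLp w (ENNReal.ofReal p) := hg.inner_const h
  have hwl : LocallyIntegrable w := hwp.locallyIntegrable hp'
  have hul : LocallyIntegrable u := hu.locallyIntegrable hp'
  have hmG : Measurable fun z : Eucl n × ℝ => w (z.1 - z.2 • h) := hwm.comp (by fun_prop)
  have hvp : MemLp (fun x => ∫ t in Set.Ioc (0 : ℝ) 1, w (x - t • h)) (ENNReal.ofReal p) := by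
    refine ⟨hmG.aestronglyMeasurable.integral_prod_right'
      (ν := volume.restrict (Set.Ioc (0 : ℝ) 1)), ?_⟩
    rw [← ENNReal.rpow_lt_top_iff_of_pos hp0, eLpNorm_rpow_eq_lintegral hp0]
    refine (lintegral_enorm_integral_rpow_le hp hmG).trans_lt ?_
    have : ∀ t : ℝ, ∫⁻ x, ‖w (x - t • h)‖ₑ ^ p = ∫⁻ x, ‖w x‖ₑ ^ p := fun t =>
      lintegral_sub_right_eq_self (fun x => ‖w x‖ₑ ^ p) (t • h)
    simp only [this, ← eLpNorm_rpow_eq_lintegral hp0]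
    simpa using ENNReal.rpow_lt_top_of_nonneg hp0.le hwp.2.ne
  -- The identity is checked against test functions: the difference moves onto `φ`, where the
  -- classical fundamental theorem applies; the weak gradient is then used for each translate of
  -- `φ`, and Fubini restores the segment integral.
  refine ae_eq_of_integral_contDiff_smul_eq ?_ (hvp.locallyIntegrable hp') fun φ hφ hφc => ?_
  · exact (hu.sub (hu.comp_measurePreserving
      (measurePreserving_sub_right volume h))).locallyIntegrable hp'
  simp only [smul_eq_mul]
  obtain ⟨hψ, hψc⟩ := fderiv_apply_continuous_hasCompactSupport hφ hφc h
  rw [integral_mul_sub_translate hul hφ.continuous hφc]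
  have e1 : ∫ x, u x * (φ x - φ (x + h)) =
      -∫ x, ∫ t in Set.Ioc (0 : ℝ) 1, fderiv ℝ φ (x + t • h) h * u x := by
    rw [← integral_neg]
    congr 1
    ext x
    rw [integral_mul_const, ← sub_translate_eq_integral_fderiv hφ]
    ring
  have e2 : ∀ t : ℝ, ∫ x, fderiv ℝ φ (x + t • h) h * u x = -∫ x, φ x * w (x - t • h) := by
    intro t
    have h1 := hug (fun x => φ (x + t • h)) (hφ.comp (contDiff_id.add contDiff_const))
      (hφc.comp_homeomorph (Homeomorph.addRight (t • h))) h
    simp only [fderiv_comp_add_right] at h1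
    rw [← integral_sub_right_eq_self (fun x => φ (x + t • h) * inner ℝ (g x) h) (t • h)] at h1
    simp only [sub_add_cancel] at h1
    rw [← h1]
    congr 1
    ext x
    ring
  rw [e1, integral_integral_swap (integrable_comp_add_smul_mul hul hum hψ hψc h)]
  simp_rw [e2]
  rw [integral_neg, neg_neg, ← integral_integral_swap
    (integrable_mul_comp_sub_smul hwl hwm hφ.continuous hφc h)]
  simp_rw [integral_const_mul, hw]

/-- Quantitative differentiability in `L^p` of Sobolev functions. -/
theorem IsWeakGradient.lintegral_sub_translate_sub_inner_le (hp : 1 ≤ p) {u : Eucl n → ℝ}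
    {g : Eucl n → Eucl n}
    (hug : IsWeakGradient u g) (hum : Measurable u) (hgm : Measurable g)
    (hu : MemLp u (ENNReal.ofReal p)) (hg : MemLp g (ENNReal.ofReal p)) (h : Eucl n) {η : ℝ≥0∞}
    (hη : ∀ t ∈ Set.Ioc (0 : ℝ) 1,
      eLpNorm (fun x => g (x - t • h) - g x) (ENNReal.ofReal p) ≤ η) :
    ∫⁻ x, ‖u x - u (x - h) - inner ℝ (g x) h‖ₑ ^ p ≤ (‖h‖ₑ * η) ^ p := by
  have hp0 : 0 < p := by linarith
  have hp' : 1 ≤ ENNReal.ofReal p := by simpa using hp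
  have hmG : Measurable fun z : Eucl n × ℝ => inner ℝ (g (z.1 - z.2 • h) - g z.1) h :=
    ((hgm.comp (by fun_prop)).sub (hgm.comp measurable_fst)).inner measurable_const
  have hwp : MemLp (fun x => (inner ℝ (g x) h : ℝ)) (ENNReal.ofReal p) := hg.inner_const h
  have hwm : Measurable fun z : Eucl n × ℝ => (inner ℝ (g (z.1 - z.2 • h)) h : ℝ) :=
    (hgm.comp (by fun_prop)).inner measurable_const
  -- Needed to subtract `⟨g x, h⟩` under the segment integral; by Tonelli the segment restrictions
  -- are in `L^p(0, 1)` for almost every `x`.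
  have hint : ∀ᵐ x, IntegrableOn (fun t : ℝ => (inner ℝ (g (x - t • h)) h : ℝ)) (Set.Ioc 0 1) := by
    have h1 : ∫⁻ x, ∫⁻ t in Set.Ioc (0 : ℝ) 1, ‖(inner ℝ (g (x - t • h)) h : ℝ)‖ₑ ^ p ≠ ∞ := by
      rw [lintegral_lintegral_swap (hwm.enorm.pow_const p).aemeasurable]
      have : ∀ t : ℝ, ∫⁻ x, ‖(inner ℝ (g (x - t • h)) h : ℝ)‖ₑ ^ p =
          ∫⁻ x, ‖(inner ℝ (g x) h : ℝ)‖ₑ ^ p := fun t =>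
        lintegral_sub_right_eq_self (fun x => ‖(inner ℝ (g x) h : ℝ)‖ₑ ^ p) (t • h)
      simp only [this, ← eLpNorm_rpow_eq_lintegral hp0]
      simpa using (ENNReal.rpow_lt_top_of_nonneg hp0.le hwp.2.ne).ne
    filter_upwards [ae_lt_top (hwm.enorm.pow_const p).lintegral_prod_right' h1] with x hx
    have h2 : MemLp (fun t : ℝ => (inner ℝ (g (x - t • h)) h : ℝ)) (ENNReal.ofReal p)
        (volume.restrict (Set.Ioc 0 1)) := by
      refine ⟨(hwm.comp measurable_prodMk_left).aestronglyMeasurable, ?_⟩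
      rwa [← ENNReal.rpow_lt_top_iff_of_pos hp0, eLpNorm_rpow_eq_lintegral hp0]
    exact h2.integrable hp'
  have e : ∀ᵐ x, u x - u (x - h) - inner ℝ (g x) h =
      ∫ t in Set.Ioc (0 : ℝ) 1, inner ℝ (g (x - t • h) - g x) h := by
    filter_upwards [hug.sub_translate_ae_eq hp hum hgm hu hg h, hint] with x hx hi
    simp_rw [inner_sub_left]
    rw [integral_sub hi (integrable_const _), ← hx]
    simp
  calc ∫⁻ x, ‖u x - u (x - h) - inner ℝ (g x) h‖ₑ ^ p
      = ∫⁻ x, ‖∫ t in Set.Ioc (0 : ℝ) 1, inner ℝ (g (x - t • h) - g x) h‖ₑ ^ p :=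
        lintegral_congr_ae (by filter_upwards [e] with x hx; rw [hx])
    _ ≤ (volume.restrict (Set.Ioc (0 : ℝ) 1)) Set.univ ^ (p - 1) * ∫⁻ t in Set.Ioc (0 : ℝ) 1,
          ∫⁻ x, ‖(inner ℝ (g (x - t • h) - g x) h : ℝ)‖ₑ ^ p :=
        lintegral_enorm_integral_rpow_le hp hmG
    _ ≤ 1 * ∫⁻ t in Set.Ioc (0 : ℝ) 1, (‖h‖ₑ * η) ^ p := by
        gcongr ?_ * ?_
        · simp
        · refine setLIntegral_mono' measurableSet_Ioc fun t ht => ?_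
          calc ∫⁻ x, ‖(inner ℝ (g (x - t • h) - g x) h : ℝ)‖ₑ ^ p
              ≤ ∫⁻ x, ‖h‖ₑ ^ p * ‖g (x - t • h) - g x‖ₑ ^ p := by
                refine lintegral_mono fun x => ?_
                rw [← ENNReal.mul_rpow_of_nonneg _ _ hp0.le]
                gcongr
                rw [mul_comm, ← ofReal_norm, ← ofReal_norm, ← ofReal_norm,
                  ← ENNReal.ofReal_mul (norm_nonneg _)]
                exact ENNReal.ofReal_le_ofReal (norm_inner_le_norm _ _)
            _ = ‖h‖ₑ ^ p * eLpNorm (fun x => g (x - t • h) - g x) (ENNReal.ofReal p) ^ p := by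
                rw [lintegral_const_mul' _ _ (by simp [hp0.le]), eLpNorm_rpow_eq_lintegral hp0]
            _ ≤ _ := by
                rw [ENNReal.mul_rpow_of_nonneg _ _ hp0.le]
                gcongr
                exact hη t ht
    _ = _ := by simp

end Translation

/-! ### Splitting the energy into small and large translations. -/

section Energy

variable {n : ℕ} {p : ℝ}

theorem quasiMeasurePreserving_sub_prod :
    Measure.QuasiMeasurePreserving (fun z : Eucl n × Eucl n => z.1 - z.2) := by
  rw [Measure.volume_eq_prod]
  exact quasiMeasurePreserving_sub volume volume

theorem anisoEnergy_congr_ae {m m' : Eucl n × Eucl n → ℝ} {u u' : Eucl n → ℝ} (hm : m =ᵐ[volume] m')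
    (hu : u =ᵐ[volume] u') (s p : ℝ) : anisoEnergy m s p u = anisoEnergy m' s p u' := by
  refine lintegral_congr_ae ?_
  have h1 : ∀ᵐ z : Eucl n × Eucl n, u z.1 = u' z.1 := by
    rw [Measure.volume_eq_prod]
    exact Measure.quasiMeasurePreserving_fst.ae hu
  have h2 : ∀ᵐ z : Eucl n × Eucl n, u (z.1 - z.2) = u' (z.1 - z.2) :=
    quasiMeasurePreserving_sub_prod.ae hu
  filter_upwards [hm, h1, h2] with z h0 h1 h2
  rw [h0, h1, h2]

/-- The radial limit only depends on the almost everywhere class of the kernel. -/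
theorem HasRadialLimit.eventually_polar (hn : 1 ≤ n) {m m' : Eucl n × Eucl n → ℝ}
    {a : Eucl n → USphere n → ℝ} (h : HasRadialLimit m a) (hm : m =ᵐ[volume] m') :
    ∀ᵐ x : Eucl n, ∀ᵐ ω : USphere n ∂(surfaceMeasure n), ∀ η > 0, ∃ δ > 0,
      ∀ᵐ r ∂(volume.restrict (Set.Ioo (0 : ℝ) 1)), r < δ →
        |m' (x, r • (ω : Eucl n)) - a x ω| ≤ η := by
  rw [Measure.volume_eq_prod] at hm
  filter_upwards [h, Measure.ae_ae_of_ae_prod hm] with x ⟨C, δ, hδ, hC⟩ hx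
  filter_upwards [hC, ae_polar_of_ae hn hx] with ω h1 h2
  intro η hη
  -- `C` may have either sign, hence `|C|`, and `+ 1` keeps the quotient meaningful when `C = 0`.
  refine ⟨min δ (η / (|C| + 1)), by positivity, ?_⟩
  filter_upwards [ae_restrict_of_ae h1, h2, ae_restrict_mem measurableSet_Ioo] with r h3 h4 h5 h6
  rw [← h4]
  refine (h3 h5.1 (h6.trans_le (min_le_left _ _))).trans ?_
  have h7 : r < η / (|C| + 1) := h6.trans_le (min_le_right _ _)
  rw [lt_div_iff₀ (by positivity)] at h7
  have h8 : C * r ≤ |C| * r := by gcongr; exacts [h5.1.le, le_abs_self C]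
  nlinarith [h5.1]

/-- The difference quotient `(u(x) - u(x - h)) / |h|`. -/
noncomputable def diffQuot (u : Eucl n → ℝ) (z : Eucl n × Eucl n) : ℝ :=
  (u z.1 - u (z.1 - z.2)) / ‖z.2‖

theorem measurable_diffQuot {u : Eucl n → ℝ} (hu : Measurable u) : Measurable (diffQuot u) :=
  ((hu.comp measurable_fst).sub (hu.comp (measurable_fst.sub measurable_snd))).div
    measurable_snd.norm

/-- With `κ = p (1 - s)` the exponents satisfy `(κ - n) + (n + s p) = p`. The factor `1 / p` is the
price of the normalization `κ` in place of `1 - s`; at `h = 0` both sides vanish. -/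
theorem energyIntegrand_eq {s : ℝ} (hp : 1 ≤ p) (hs : s < 1) (c : ℝ) (u : Eucl n → ℝ)
    (z : Eucl n × Eucl n) :
    ENNReal.ofReal (1 - s) *
        ENNReal.ofReal (c * (|u z.1 - u (z.1 - z.2)| ^ p / ‖z.2‖ ^ ((n : ℝ) + s * p))) =
      ENNReal.ofReal (1 / p) * (ENNReal.ofReal (p * (1 - s) * ‖z.2‖ ^ (p * (1 - s) - n)) *
        ENNReal.ofReal (c * |diffQuot u z| ^ p)) := by
  have hp0 : 0 < p := by linarith
  have hs' : 0 < 1 - s := by linarith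
  rw [← ENNReal.ofReal_mul hs'.le, ← ENNReal.ofReal_mul (by positivity),
    ← ENNReal.ofReal_mul (by positivity)]
  congr 1
  by_cases hz : z.2 = 0
  · simp [hz, diffQuot, Real.zero_rpow hp0.ne']
  · have hz' : 0 < ‖z.2‖ := norm_pos_iff.2 hz
    rw [diffQuot, abs_div, abs_norm, Real.div_rpow (abs_nonneg _) hz'.le]
    have e : ‖z.2‖ ^ (p * (1 - s) - n) * ‖z.2‖ ^ ((n : ℝ) + s * p) = ‖z.2‖ ^ p := by
      rw [← Real.rpow_add hz']
      congr 1
      ring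
    have h1 := Real.rpow_pos_of_pos hz' p
    have h2 := Real.rpow_pos_of_pos hz' ((n : ℝ) + s * p)
    rw [← e]
    have h3 := Real.rpow_pos_of_pos hz' (p * (1 - s) - n)
    field_simp

/-- The part of the energy with `|h| < 1`, in polar form. -/
theorem near_energy_eq (hn : 1 ≤ n) (hp : 1 ≤ p) {m : Eucl n × Eucl n → ℝ} (hm : Measurable m)
    {u : Eucl n → ℝ} (hu : Measurable u) {s : ℝ} (hs : s < 1) :
    ENNReal.ofReal (1 - s) * ∫⁻ z : Eucl n × Eucl n in {z | z.2 ∈ ball 0 1},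
        ENNReal.ofReal (m z * (|u z.1 - u (z.1 - z.2)| ^ p / ‖z.2‖ ^ ((n : ℝ) + s * p))) =
      ENNReal.ofReal (1 / p) * ∫⁻ z, ENNReal.ofReal (m z * |diffQuot u z| ^ p)
        ∂((volume : Measure (Eucl n)).prod (polarKernel n (p * (1 - s)))) := by
  have hκ : 0 < p * (1 - s) := mul_pos (by linarith) (by linarith)
  have := isFiniteMeasure_polarKernel (n := n) hκ
  have hF : Measurable fun z => ENNReal.ofReal (m z * |diffQuot u z| ^ p) :=
    (hm.mul ((measurable_diffQuot hu).abs.pow_const p)).ennreal_ofReal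
  have hD : Measurable fun h : Eucl n =>
      ENNReal.ofReal (p * (1 - s) * ‖h‖ ^ (p * (1 - s) - n)) :=
    ((measurable_norm.pow_const _).const_mul _).ennreal_ofReal
  have hset : {z : Eucl n × Eucl n | z.2 ∈ ball 0 1} = Set.univ ×ˢ ball 0 1 := by
    ext z; simp
  rw [← lintegral_const_mul' _ _ ENNReal.ofReal_ne_top,
    ← lintegral_const_mul' _ _ ENNReal.ofReal_ne_top]
  simp_rw [energyIntegrand_eq hp hs]
  rw [hset, Measure.volume_eq_prod, ← Measure.prod_restrict, Measure.restrict_univ,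
    lintegral_prod _ (Measurable.aemeasurable ?_), lintegral_prod _ (hF.const_mul _).aemeasurable]
  · refine lintegral_congr fun x => ?_
    have hFx : Measurable fun h => ENNReal.ofReal (1 / p) *
        ENNReal.ofReal (m (x, h) * |diffQuot u (x, h)| ^ p) :=
      (hF.comp measurable_prodMk_left).const_mul _
    rw [polarKernel_eq_withDensity hn hκ, lintegral_withDensity_eq_lintegral_mul _ hD hFx]
    refine lintegral_congr fun h => ?_
    simp only [Pi.mul_apply]
    ring
  · exact ((hD.comp measurable_snd).mul hF).const_mul _

theorem lintegral_sub_translate_le (hp : 1 ≤ p) {u : Eucl n → ℝ} (hu : Measurable u) (h : Eucl n) :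
    ∫⁻ x, ‖u x - u (x - h)‖ₑ ^ p ≤ (2 * eLpNorm u (ENNReal.ofReal p)) ^ p := by
  rw [← eLpNorm_rpow_eq_lintegral (by linarith)]
  gcongr
  have h1 := eLpNorm_sub_le (p := ENNReal.ofReal p) (μ := volume) hu.aestronglyMeasurable
    (hu.comp (measurable_sub_const h)).aestronglyMeasurable (by simpa using hp)
  refine h1.trans (le_of_eq ?_)
  rw [two_mul]
  congr 1
  exact eLpNorm_comp_measurePreserving hu.aestronglyMeasurable
    (measurePreserving_sub_right volume h)

/-- Any exponent above `n` is integrable at infinity; `n + 1/2` is chosen because it stays below `n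
+ s p` as soon as `s > 1/2`, given `p ≥ 1`. -/
theorem lintegral_norm_rpow_compl_ball_lt_top (n : ℕ) :
    ∫⁻ h : Eucl n in (ball 0 1)ᶜ, ENNReal.ofReal (‖h‖ ^ (-((n : ℝ) + 1 / 2))) < ∞ := by
  have h1 : Integrable fun h : Eucl n => (1 + ‖h‖) ^ (-((n : ℝ) + 1 / 2)) :=
    integrable_one_add_norm (by rw [finrank_euclideanSpace_fin]; linarith)
  have h2 := (h1.const_mul (2 ^ ((n : ℝ) + 1 / 2))).lintegral_lt_top
  refine lt_of_le_of_lt ?_ h2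
  refine le_trans (setLIntegral_mono' measurableSet_ball.compl fun h hh => ?_)
    (setLIntegral_le_lintegral _ _)
  refine ENNReal.ofReal_le_ofReal ?_
  have h3 : 1 ≤ ‖h‖ := by simpa using hh
  have h4 : (0 : ℝ) ≤ (n : ℝ) + 1 / 2 := by positivity
  rw [Real.rpow_neg (by positivity), Real.rpow_neg (by positivity), ← div_eq_mul_inv,
    ← one_div, div_le_div_iff₀ (by positivity) (by positivity), one_mul,
    ← Real.mul_rpow (by positivity) (by positivity)]
  exact Real.rpow_le_rpow (by positivity) (by linarith) h4

/-- The part of the energy with `|h| ≥ 1` does not contribute to the limit. -/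
theorem tendsto_far_energy (hp : 1 ≤ p) {m : Eucl n × Eucl n → ℝ} {M : ℝ}
    (hM : ∀ z, m z ≤ M) {u : Eucl n → ℝ} (hu : Measurable u) (hup : MemLp u (ENNReal.ofReal p)) :
    Tendsto (fun s : ℝ => ENNReal.ofReal (1 - s) * ∫⁻ z : Eucl n × Eucl n in {z | z.2 ∈ ball 0 1}ᶜ,
        ENNReal.ofReal (m z * (|u z.1 - u (z.1 - z.2)| ^ p / ‖z.2‖ ^ ((n : ℝ) + s * p))))
      (𝓝[<] 1) (𝓝 0) := by
  have hp0 : 0 < p := by linarith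
  set J := ∫⁻ h : Eucl n in (ball 0 1)ᶜ, ENNReal.ofReal (‖h‖ ^ (-((n : ℝ) + 1 / 2))) with hJ
  set D := ENNReal.ofReal M * ((2 * eLpNorm u (ENNReal.ofReal p)) ^ p * J) with hD
  have hDtop : D ≠ ∞ := by
    refine ENNReal.mul_ne_top ENNReal.ofReal_ne_top (ENNReal.mul_ne_top ?_
      (lintegral_norm_rpow_compl_ball_lt_top n).ne)
    exact ENNReal.rpow_ne_top_of_nonneg hp0.le (ENNReal.mul_ne_top (by simp) hup.2.ne)
  have h0 : Tendsto (fun s : ℝ => ENNReal.ofReal (1 - s) * D) (𝓝[<] 1) (𝓝 0) := by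
    have h1 : Tendsto (fun s : ℝ => ENNReal.ofReal (1 - s)) (𝓝 1) (𝓝 0) := by
      have h2 : Continuous fun s : ℝ => ENNReal.ofReal (1 - s) :=
        ENNReal.continuous_ofReal.comp (by fun_prop)
      simpa using h2.tendsto 1
    have := ENNReal.Tendsto.mul_const (b := D) (h1.mono_left (nhdsWithin_le_nhds (s := Set.Iio 1))) (Or.inr hDtop)
    simpa using this
  have hset : {z : Eucl n × Eucl n | z.2 ∈ ball 0 1}ᶜ = Set.univ ×ˢ (ball 0 1)ᶜ := by
    ext z; simp
  refine tendsto_of_tendsto_of_tendsto_of_le_of_le' tendsto_const_nhds h0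
    (Eventually.of_forall fun _ => zero_le) ?_
  have hs1 : ∀ᶠ s : ℝ in 𝓝[<] 1, 1 / 2 < s :=
    nhdsWithin_le_nhds (lt_mem_nhds (by norm_num))
  filter_upwards [hs1] with s hs
  gcongr
  have hDm : Measurable fun z : Eucl n × Eucl n => u z.1 - u (z.1 - z.2) :=
    (hu.comp measurable_fst).sub (hu.comp (measurable_fst.sub measurable_snd))
  have hHm : Measurable fun h : Eucl n => ENNReal.ofReal (‖h‖ ^ (-((n : ℝ) + 1 / 2))) :=
    (measurable_norm.pow_const _).ennreal_ofReal
  calc _ ≤ ∫⁻ z : Eucl n × Eucl n in {z | z.2 ∈ ball 0 1}ᶜ, ENNReal.ofReal M *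
        (‖u z.1 - u (z.1 - z.2)‖ₑ ^ p * ENNReal.ofReal (‖z.2‖ ^ (-((n : ℝ) + 1 / 2)))) := by
        refine setLIntegral_mono' (measurableSet_ball.preimage measurable_snd).compl
          fun z hz => ?_
        have hz1 : 1 ≤ ‖z.2‖ := by simpa using hz
        have hz0 : 0 < ‖z.2‖ := by linarith
        have h3 : |u z.1 - u (z.1 - z.2)| ^ p / ‖z.2‖ ^ ((n : ℝ) + s * p) ≤
            |u z.1 - u (z.1 - z.2)| ^ p * ‖z.2‖ ^ (-((n : ℝ) + 1 / 2)) := by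
          rw [div_eq_mul_inv, ← Real.rpow_neg hz0.le]
          gcongr
          nlinarith
        calc ENNReal.ofReal (m z * (|u z.1 - u (z.1 - z.2)| ^ p / ‖z.2‖ ^ ((n : ℝ) + s * p)))
            ≤ ENNReal.ofReal (M *
              (|u z.1 - u (z.1 - z.2)| ^ p / ‖z.2‖ ^ ((n : ℝ) + s * p))) := by
              refine ENNReal.ofReal_le_ofReal ?_
              gcongr
              exact hM z
          _ = ENNReal.ofReal M * ENNReal.ofReal
              (|u z.1 - u (z.1 - z.2)| ^ p / ‖z.2‖ ^ ((n : ℝ) + s * p)) :=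
              ENNReal.ofReal_mul' (by positivity)
          _ ≤ ENNReal.ofReal M * ENNReal.ofReal
              (|u z.1 - u (z.1 - z.2)| ^ p * ‖z.2‖ ^ (-((n : ℝ) + 1 / 2))) := by gcongr
          _ = _ := by
              rw [ENNReal.ofReal_mul (by positivity), ← ENNReal.ofReal_rpow_of_nonneg
                (abs_nonneg _) hp0.le, ← Real.norm_eq_abs, ofReal_norm]
    _ = ENNReal.ofReal M * ∫⁻ h : Eucl n in (ball 0 1)ᶜ, ∫⁻ x,
          ‖u x - u (x - h)‖ₑ ^ p * ENNReal.ofReal (‖h‖ ^ (-((n : ℝ) + 1 / 2))) := by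
        rw [lintegral_const_mul' _ _ ENNReal.ofReal_ne_top, hset, Measure.volume_eq_prod,
          ← Measure.prod_restrict, Measure.restrict_univ, lintegral_prod_symm]
        exact ((hDm.enorm.pow_const p).mul (hHm.comp measurable_snd)).aemeasurable
    _ ≤ D := by
        rw [hD, hJ]
        gcongr
        rw [← lintegral_const_mul _ hHm]
        refine lintegral_mono fun h => ?_
        rw [lintegral_mul_const' _ _ ENNReal.ofReal_ne_top]
        gcongr
        exact lintegral_sub_translate_le hp hu h

theorem anisoEnergy_eq_near_add_far (s : ℝ) (m : Eucl n × Eucl n → ℝ) (u : Eucl n → ℝ) :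
    anisoEnergy m s p u =
      (∫⁻ z : Eucl n × Eucl n in {z | z.2 ∈ ball 0 1},
        ENNReal.ofReal (m z * (|u z.1 - u (z.1 - z.2)| ^ p / ‖z.2‖ ^ ((n : ℝ) + s * p)))) +
      ∫⁻ z : Eucl n × Eucl n in {z | z.2 ∈ ball 0 1}ᶜ,
        ENNReal.ofReal (m z * (|u z.1 - u (z.1 - z.2)| ^ p / ‖z.2‖ ^ ((n : ℝ) + s * p))) :=
  (lintegral_add_compl _ (measurableSet_ball.preimage measurable_snd)).symm

theorem tendsto_mul_one_sub (hp : 0 < p) :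
    Tendsto (fun s : ℝ => p * (1 - s)) (𝓝[<] 1) (𝓝[>] 0) := by
  refine tendsto_nhdsWithin_iff.2 ⟨?_, ?_⟩
  · have h : Continuous fun s : ℝ => p * (1 - s) := by fun_prop
    have := (h.tendsto 1).mono_left (nhdsWithin_le_nhds (s := Set.Iio 1))
    simpa using this
  · filter_upwards [self_mem_nhdsWithin] with s hs
    exact mul_pos hp (sub_pos.2 hs)

end Energy

/-! ### The limit for Sobolev functions. -/

section Sobolev

variable {n : ℕ} {p : ℝ}

/-- The linearization `⟨g(x), h⟩ / |h|` of the difference quotient. -/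
noncomputable def linQuot (g : Eucl n → Eucl n) (z : Eucl n × Eucl n) : ℝ :=
  inner ℝ (g z.1) z.2 / ‖z.2‖

theorem measurable_linQuot {g : Eucl n → Eucl n} (hg : Measurable g) : Measurable (linQuot g) :=
  ((hg.comp measurable_fst).inner measurable_snd).div measurable_snd.norm

theorem abs_linQuot_le (g : Eucl n → Eucl n) (z : Eucl n × Eucl n) : |linQuot g z| ≤ ‖g z.1‖ := by
  rw [linQuot, abs_div, abs_norm]
  exact div_le_of_le_mul₀ (norm_nonneg _) (norm_nonneg _) (abs_real_inner_le_norm _ _)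

theorem linQuot_smul_sphere (g : Eucl n → Eucl n) (x : Eucl n) {r : ℝ} (hr : 0 < r)
    (ω : USphere n) : linQuot g (x, r • (ω : Eucl n)) = inner ℝ (g x) (ω : Eucl n) := by
  rw [linQuot, norm_smul_sphere hr.le, inner_smul_right]
  field_simp

/-- The limit of the linearized energy. -/
theorem tendsto_linear_energy (hp : 1 ≤ p) {m : Eucl n × Eucl n → ℝ} (hm : Measurable m)
    {M : ℝ} (hm0 : ∀ z, 0 ≤ m z) (hM : ∀ z, m z ≤ M) {a : Eucl n → USphere n → ℝ}
    (ha : ∀ᵐ x : Eucl n, ∀ᵐ ω : USphere n ∂(surfaceMeasure n), ∀ η > 0, ∃ δ > 0,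
      ∀ᵐ r ∂(volume.restrict (Set.Ioo (0 : ℝ) 1)), r < δ →
        |m (x, r • (ω : Eucl n)) - a x ω| ≤ η)
    {g : Eucl n → Eucl n} (hgm : Measurable g) (hg : MemLp g (ENNReal.ofReal p)) :
    Integrable (fun x => limitDensity p a x (g x)) ∧
    Tendsto (fun κ => ∫⁻ z, ENNReal.ofReal (m z * |linQuot g z| ^ p)
        ∂((volume : Measure (Eucl n)).prod (polarKernel n κ)))
      (𝓝[>] 0) (𝓝 (ENNReal.ofReal (∫ x, p * limitDensity p a x (g x)))) := by
  have hp0 : 0 < p := by linarith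
  have hM0 : 0 ≤ M := (hm0 0).trans (hM 0)
  set f : Eucl n × Eucl n → ℝ := fun z => m z * |linQuot g z| ^ p with hf
  have hfm : Measurable f := hm.mul ((measurable_linQuot hgm).abs.pow_const p)
  have hf0 : ∀ z, 0 ≤ f z := fun z => mul_nonneg (hm0 z) (by positivity)
  have hfM : ∀ z, f z ≤ M * ‖g z.1‖ ^ p := by
    intro z
    exact mul_le_mul (hM z) (Real.rpow_le_rpow (abs_nonneg _) (abs_linQuot_le g z) hp0.le)
      (by positivity) hM0
  have hgi : Integrable fun x => ‖g x‖ ^ p := by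
    have := hg.integrable_norm_rpow (by simpa using hp0) ENNReal.ofReal_ne_top
    rwa [ENNReal.toReal_ofReal hp0.le] at this
  set σ : ℝ := (surfaceMeasure n Set.univ).toReal with hσ
  have hpt : ∀ᵐ x, Tendsto (fun κ => ∫ h, f (x, h) ∂(polarKernel n κ)) (𝓝[>] 0)
      (𝓝 (p * limitDensity p a x (g x))) := by
    filter_upwards [ha] with x hx
    have e : p * limitDensity p a x (g x) =
        ∫ ω : USphere n, a x ω * |inner ℝ (g x) (ω : Eucl n)| ^ p ∂(surfaceMeasure n) := by
      rw [limitDensity, ← mul_assoc, mul_one_div_cancel hp0.ne', one_mul]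
    rw [e]
    refine tendsto_integral_polarKernel (M := M * ‖g x‖ ^ p) (hfm.comp measurable_prodMk_left)
      (fun h => by rw [Function.comp_apply, abs_of_nonneg (hf0 _)]; exact hfM (x, h)) ?_
    filter_upwards [hx] with ω hω η hη
    have hgx : 0 ≤ ‖g x‖ ^ p := by positivity
    obtain ⟨δ, hδ, h1⟩ := hω (η / (‖g x‖ ^ p + 1)) (by positivity)
    refine ⟨δ, hδ, ?_⟩
    filter_upwards [h1, ae_restrict_mem measurableSet_Ioo] with r h2 h3 h4
    simp only [Function.comp_apply, hf]
    -- `linQuot g` does not depend on `r` along the ray, so only `m` contributes to the error.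
    rw [linQuot_smul_sphere g x h3.1, ← sub_mul, abs_mul, abs_of_nonneg (a := |_| ^ p) (by positivity)]
    have h5 : |inner ℝ (g x) (ω : Eucl n)| ^ p ≤ ‖g x‖ ^ p := by
      refine Real.rpow_le_rpow (abs_nonneg _) ((abs_real_inner_le_norm _ _).trans ?_) hp0.le
      rw [norm_eq_of_mem_sphere, mul_one]
    calc _ ≤ η / (‖g x‖ ^ p + 1) * ‖g x‖ ^ p := by
          gcongr
          exact h2 h4
      _ ≤ η / (‖g x‖ ^ p + 1) * (‖g x‖ ^ p + 1) := by gcongr; linarith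
      _ = η := by field_simp
  have hmeas : ∀ κ > 0, AEStronglyMeasurable (fun x => ∫ h, f (x, h) ∂(polarKernel n κ)) volume := by
    intro κ hκ
    have := isFiniteMeasure_polarKernel (n := n) hκ
    exact hfm.aestronglyMeasurable.integral_prod_right' (ν := polarKernel n κ)
  have hbd : ∀ κ > 0, ∀ x, ‖∫ h, f (x, h) ∂(polarKernel n κ)‖ ≤ M * ‖g x‖ ^ p * σ := by
    intro κ hκ x
    have := isFiniteMeasure_polarKernel (n := n) hκ
    refine (norm_integral_le_of_norm_le_const (C := M * ‖g x‖ ^ p)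
      (Eventually.of_forall fun h => ?_)).trans_eq ?_
    · rw [Real.norm_of_nonneg (hf0 _)]; exact hfM (x, h)
    · rw [Measure.real, polarKernel_univ hκ]
  have hbi : Integrable fun x => M * ‖g x‖ ^ p * σ := (hgi.const_mul M).mul_const σ
  have hlim : Integrable fun x => p * limitDensity p a x (g x) := by
    -- Measurability of the limit density is not assumed of `a`: it is inherited from the averages
    -- over the kernel, which converge almost everywhere along a sequence.
    obtain ⟨v, hv⟩ := (𝓝[>] (0 : ℝ)).exists_seq_tendsto
    obtain ⟨hv0, hvpos⟩ := tendsto_nhdsWithin_iff.1 hv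
    obtain ⟨N, hN⟩ := eventually_atTop.1 hvpos
    have hv' : Tendsto (fun k => v (k + N)) atTop (𝓝[>] 0) := hv.comp (tendsto_add_atTop_nat N)
    have hm1 : AEStronglyMeasurable (fun x => p * limitDensity p a x (g x)) volume := by
      refine aestronglyMeasurable_of_tendsto_ae atTop
        (f := fun k x => ∫ h, f (x, h) ∂(polarKernel n (v (k + N)))) (fun k => ?_) ?_
      · exact hmeas _ (hN _ (by omega))
      · filter_upwards [hpt] with x hx using hx.comp hv'
    refine hbi.mono' hm1 ?_
    filter_upwards [hpt] with x hx
    refine le_of_tendsto hx.norm ?_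
    filter_upwards [self_mem_nhdsWithin] with κ hκ using hbd κ hκ x
  have hDCT : Tendsto (fun κ => ∫ x, ∫ h, f (x, h) ∂(polarKernel n κ)) (𝓝[>] 0)
      (𝓝 (∫ x, p * limitDensity p a x (g x))) := by
    refine tendsto_integral_filter_of_dominated_convergence (fun x => M * ‖g x‖ ^ p * σ) ?_ ?_
      hbi hpt
    · filter_upwards [self_mem_nhdsWithin] with κ hκ using hmeas κ hκ
    · filter_upwards [self_mem_nhdsWithin] with κ hκ using Eventually.of_forall (hbd κ hκ)
  refine ⟨?_, ?_⟩
  · have := hlim.const_mul (1 / p)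
    refine this.congr (Eventually.of_forall fun x => ?_)
    simp only
    field_simp
  · refine ((ENNReal.continuous_ofReal.tendsto _).comp hDCT).congr' ?_
    filter_upwards [self_mem_nhdsWithin] with κ hκ
    have := isFiniteMeasure_polarKernel (n := n) hκ
    have hfi : Integrable f ((volume : Measure (Eucl n)).prod (polarKernel n κ)) := by
      refine Integrable.mono' ((hgi.const_mul M).mul_prod (integrable_const (1 : ℝ)))
        hfm.aestronglyMeasurable (Eventually.of_forall fun z => ?_)
      rw [Real.norm_of_nonneg (hf0 z), mul_one]
      exact hfM z
    rw [Function.comp_apply, ← integral_prod _ hfi,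
      ofReal_integral_eq_lintegral_ofReal hfi (Eventually.of_forall hf0)]

/-- Linearization error of the energy. -/
theorem tendsto_lintegral_diffQuot_sub_linQuot (hp : 1 ≤ p) {u : Eucl n → ℝ}
    {g : Eucl n → Eucl n} (hug : IsWeakGradient u g) (hum : Measurable u) (hgm : Measurable g)
    (hu : MemLp u (ENNReal.ofReal p)) (hg : MemLp g (ENNReal.ofReal p)) :
    Tendsto (fun κ => ∫⁻ z, ‖diffQuot u z - linQuot g z‖ₑ ^ p
        ∂((volume : Measure (Eucl n)).prod (polarKernel n κ))) (𝓝[>] 0) (𝓝 0) := by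
  have hp0 : 0 < p := by linarith
  have hp' : 1 ≤ ENNReal.ofReal p := by simpa using hp
  set ω : Eucl n → ℝ≥0∞ := fun h => eLpNorm (fun x => g (x - h) - g x) (ENNReal.ofReal p) with hω
  -- The linearization error at `h` involves `g` along the whole segment, hence the supremum over
  -- `t`. `Φ` is bounded and tends to `0` at the origin, which is all the kernels see in the limit.
  set Φ : Eucl n → ℝ≥0∞ := fun h => (⨆ t ∈ Set.Ioc (0 : ℝ) 1, ω (t • h)) ^ p with hΦ
  have hωB : ∀ h, ω h ≤ 2 * eLpNorm g (ENNReal.ofReal p) := by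
    intro h
    have h1 := eLpNorm_sub_le (p := ENNReal.ofReal p) (μ := volume)
      (hgm.comp (measurable_sub_const h)).aestronglyMeasurable hgm.aestronglyMeasurable hp'
    refine h1.trans (le_of_eq ?_)
    rw [two_mul]
    congr 1
    exact eLpNorm_comp_measurePreserving hgm.aestronglyMeasurable
      (measurePreserving_sub_right volume h)
  have hΦlim : Tendsto Φ (𝓝 0) (𝓝 0) := by
    have h1 : Tendsto (fun h : Eucl n => ⨆ t ∈ Set.Ioc (0 : ℝ) 1, ω (t • h)) (𝓝 0) (𝓝 0) := by
      rw [ENNReal.tendsto_nhds_zero]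
      intro ε hε
      have h2 := ENNReal.tendsto_nhds_zero.1
        (tendsto_eLpNorm_translate_sub hp' ENNReal.ofReal_ne_top hg) ε hε
      obtain ⟨δ, hδ, h3⟩ := Metric.eventually_nhds_iff_ball.1 h2
      filter_upwards [ball_mem_nhds (0 : Eucl n) hδ] with h hh
      refine iSup₂_le fun t ht => h3 _ ?_
      rw [mem_ball_zero_iff] at hh ⊢
      rw [norm_smul, Real.norm_of_nonneg ht.1.le]
      exact (mul_le_of_le_one_left (norm_nonneg _) ht.2).trans_lt hh
    have h2 := ((ENNReal.continuous_rpow_const (y := p)).tendsto 0).comp h1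
    rwa [ENNReal.zero_rpow_of_pos hp0] at h2
  have hΦB : ∀ h, Φ h ≤ (2 * eLpNorm g (ENNReal.ofReal p)) ^ p := fun h => by
    simp only [hΦ]
    gcongr
    exact iSup₂_le fun t ht => hωB _
  have key := tendsto_lintegral_polarKernel_zero (n := n)
    (ENNReal.rpow_ne_top_of_nonneg hp0.le (ENNReal.mul_ne_top (by simp) hg.2.ne)) hΦB hΦlim
  refine tendsto_of_tendsto_of_tendsto_of_le_of_le' tendsto_const_nhds key
    (Eventually.of_forall fun _ => zero_le) ?_
  filter_upwards [self_mem_nhdsWithin] with κ hκ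
  have := isFiniteMeasure_polarKernel (n := n) hκ
  have hmz : Measurable fun z => ‖diffQuot u z - linQuot g z‖ₑ ^ p :=
    ((measurable_diffQuot hum).sub (measurable_linQuot hgm)).enorm.pow_const p
  rw [lintegral_prod_symm _ hmz.aemeasurable]
  refine lintegral_mono fun h => ?_
  by_cases hh : h = 0
  · simp [hh, diffQuot, linQuot, hp0]
  have hh0 : ‖h‖ₑ ≠ 0 := by simpa using hh
  have e : ∀ x, ‖diffQuot u (x, h) - linQuot g (x, h)‖ₑ ^ p =
      (‖h‖ₑ⁻¹) ^ p * ‖u x - u (x - h) - inner ℝ (g x) h‖ₑ ^ p := by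
    intro x
    rw [← ENNReal.mul_rpow_of_nonneg _ _ hp0.le, diffQuot, linQuot, ← sub_div, div_eq_inv_mul,
      enorm_mul, enorm_inv (norm_ne_zero_iff.2 hh), enorm_norm]
  simp only [e]
  rw [lintegral_const_mul' _ _ (by simp [hh])]
  calc _ ≤ (‖h‖ₑ⁻¹) ^ p * (‖h‖ₑ * ⨆ t ∈ Set.Ioc (0 : ℝ) 1, ω (t • h)) ^ p := by
        gcongr
        exact hug.lintegral_sub_translate_sub_inner_le hp hum hgm hu hg h
          fun t ht => le_iSup₂ (f := fun t (_ : t ∈ Set.Ioc (0 : ℝ) 1) => ω (t • h)) t ht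
    _ = Φ h := by
        rw [← ENNReal.mul_rpow_of_nonneg _ _ hp0.le, ← mul_assoc,
          ENNReal.inv_mul_cancel hh0 enorm_ne_top, one_mul]

theorem ENNReal.tendsto_of_le_add {ι : Type*} {l : Filter ι} {f a d : ι → ℝ≥0∞} {L : ℝ≥0∞}
    (ha : Tendsto a l (𝓝 L)) (hd : Tendsto d l (𝓝 0)) (h1 : ∀ᶠ i in l, f i ≤ a i + d i)
    (h2 : ∀ᶠ i in l, a i ≤ f i + d i) : Tendsto f l (𝓝 L) := by
  have hu : Tendsto (fun i => a i + d i) l (𝓝 L) := by simpa using ha.add hd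
  have hl : Tendsto (fun i => a i - d i) l (𝓝 L) := by
    simpa using ENNReal.Tendsto.sub ha hd (Or.inr ENNReal.zero_ne_top)
  refine tendsto_of_tendsto_of_tendsto_of_le_of_le' hl hu ?_ h1
  filter_upwards [h2] with i hi using tsub_le_iff_right.2 hi

/-- Absorbing `m^{1/p}` into the function makes the weighted energy a power of an `L^p` norm, so
that Minkowski's inequality applies. -/
theorem lintegral_ofReal_mul_abs_rpow {α : Type*} [MeasurableSpace α] {μ : Measure α}
    (hp : 0 < p) {m F : α → ℝ} (hm : ∀ z, 0 ≤ m z) :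
    ∫⁻ z, ENNReal.ofReal (m z * |F z| ^ p) ∂μ =
      eLpNorm (fun z => m z ^ (1 / p) * F z) (ENNReal.ofReal p) μ ^ p := by
  rw [eLpNorm_rpow_eq_lintegral hp]
  refine lintegral_congr fun z => ?_
  rw [← ofReal_norm, ENNReal.ofReal_rpow_of_nonneg (norm_nonneg _) hp.le, norm_mul,
    Real.norm_of_nonneg (Real.rpow_nonneg (hm z) _), Real.mul_rpow
      (Real.rpow_nonneg (hm z) _) (norm_nonneg _), ← Real.rpow_mul (hm z),
    one_div_mul_cancel hp.ne', Real.rpow_one, Real.norm_eq_abs]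

/-- The Bourgain–Brezis–Mironescu limit for Sobolev functions and regular representatives. -/
theorem tendsto_near_energy (hp : 1 ≤ p) {m : Eucl n × Eucl n → ℝ} (hm : Measurable m)
    {M : ℝ} (hm0 : ∀ z, 0 ≤ m z) (hM : ∀ z, m z ≤ M) {u : Eucl n → ℝ}
    {g : Eucl n → Eucl n} (hug : IsWeakGradient u g) (hum : Measurable u) (hgm : Measurable g)
    (hu : MemLp u (ENNReal.ofReal p)) (hg : MemLp g (ENNReal.ofReal p)) {L : ℝ≥0∞}
    (hL : Tendsto (fun κ => ∫⁻ z, ENNReal.ofReal (m z * |linQuot g z| ^ p)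
        ∂((volume : Measure (Eucl n)).prod (polarKernel n κ))) (𝓝[>] 0) (𝓝 L)) :
    Tendsto (fun κ => ∫⁻ z, ENNReal.ofReal (m z * |diffQuot u z| ^ p)
        ∂((volume : Measure (Eucl n)).prod (polarKernel n κ))) (𝓝[>] 0) (𝓝 L) := by
  have hp0 : 0 < p := by linarith
  have hp' : 1 ≤ ENNReal.ofReal p := by simpa using hp
  have hM0 : 0 ≤ M := (hm0 0).trans (hM 0)
  have herr := tendsto_lintegral_diffQuot_sub_linQuot hp hug hum hgm hu hg
  have herr2 : Tendsto (fun κ => ∫⁻ z, ENNReal.ofReal (m z * |diffQuot u z - linQuot g z| ^ p)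
      ∂((volume : Measure (Eucl n)).prod (polarKernel n κ))) (𝓝[>] 0) (𝓝 0) := by
    have h1 := ENNReal.Tendsto.const_mul (a := ENNReal.ofReal M) herr (Or.inr ENNReal.ofReal_ne_top)
    rw [mul_zero] at h1
    refine tendsto_of_tendsto_of_tendsto_of_le_of_le tendsto_const_nhds h1
      (fun _ => zero_le) fun κ => ?_
    simp only
    rw [← lintegral_const_mul' _ _ ENNReal.ofReal_ne_top]
    refine lintegral_mono fun z => ?_
    rw [ENNReal.ofReal_mul (hm0 z), ← ENNReal.ofReal_rpow_of_nonneg (abs_nonneg _) hp0.le,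
      ← Real.norm_eq_abs, ofReal_norm]
    gcongr
    exact hM z
  simp_rw [lintegral_ofReal_mul_abs_rpow hp0 hm0] at hL herr2 ⊢
  have hrt : ∀ {f : ℝ → ℝ≥0∞} {c : ℝ≥0∞}, Tendsto (fun κ => f κ ^ p) (𝓝[>] 0) (𝓝 c) →
      Tendsto f (𝓝[>] 0) (𝓝 (c ^ (1 / p))) := by
    intro f c h
    have := ((ENNReal.continuous_rpow_const (y := 1 / p)).tendsto c).comp h
    refine this.congr fun κ => ?_
    rw [Function.comp_apply, ← ENNReal.rpow_mul, mul_one_div_cancel hp0.ne', ENNReal.rpow_one]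
  have hL' := hrt hL
  have herr' := hrt herr2
  rw [ENNReal.zero_rpow_of_pos (by positivity)] at herr'
  have hmF : Measurable fun z => m z ^ (1 / p) * diffQuot u z :=
    (hm.pow_const _).mul (measurable_diffQuot hum)
  have hmG : Measurable fun z => m z ^ (1 / p) * linQuot g z :=
    (hm.pow_const _).mul (measurable_linQuot hgm)
  have hmD : Measurable fun z => m z ^ (1 / p) * (diffQuot u z - linQuot g z) :=
    (hm.pow_const _).mul ((measurable_diffQuot hum).sub (measurable_linQuot hgm))
  have hF := ENNReal.tendsto_of_le_add (f := fun κ =>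
    eLpNorm (fun z => m z ^ (1 / p) * diffQuot u z) (ENNReal.ofReal p)
      ((volume : Measure (Eucl n)).prod (polarKernel n κ))) hL' herr'
    (Eventually.of_forall fun κ => ?_) (Eventually.of_forall fun κ => ?_)
  · have := ((ENNReal.continuous_rpow_const (y := p)).tendsto _).comp hF
    rwa [← ENNReal.rpow_mul, one_div_mul_cancel hp0.ne', ENNReal.rpow_one] at this
  · refine le_trans (le_of_eq ?_) (eLpNorm_add_le hmG.aestronglyMeasurable
      hmD.aestronglyMeasurable hp')
    congr 1
    ext z
    simp only [Pi.add_apply]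
    ring
  · refine le_trans (le_of_eq ?_) (eLpNorm_sub_le hmF.aestronglyMeasurable
      hmD.aestronglyMeasurable hp')
    congr 1
    ext z
    simp only [Pi.sub_apply]
    ring

end Sobolev

/-! ### Bounded energies produce a weak gradient. -/

section Characterization

variable {n : ℕ} {p : ℝ}

theorem integrable_smul_fderiv {u φ : Eucl n → ℝ} (hu : LocallyIntegrable u)
    (hφ : ContDiff ℝ ((⊤ : ℕ∞) : WithTop ℕ∞) φ) (hφc : HasCompactSupport φ) :
    Integrable fun x => u x • fderiv ℝ φ x :=
  hu.integrable_smul_right_of_hasCompactSupport (hφ.continuous_fderiv (by simp)) (hφc.fderiv ℝ)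

theorem integral_smul_fderiv_apply {u φ : Eucl n → ℝ} (hu : LocallyIntegrable u)
    (hφ : ContDiff ℝ ((⊤ : ℕ∞) : WithTop ℕ∞) φ) (hφc : HasCompactSupport φ) (v : Eucl n) :
    (∫ x, u x • fderiv ℝ φ x) v = ∫ x, u x * fderiv ℝ φ x v := by
  rw [ContinuousLinearMap.integral_apply (integrable_smul_fderiv hu hφ hφc)]
  rfl

/-- `φ` is Lipschitz, and for `‖h‖ ≤ 1` both `φ x` and `φ (x + h)` vanish outside a ball one unit
larger than that containing the support. The majorant is the Lipschitz constant times `|u|` on that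
ball. -/
theorem exists_integrable_bound_sub_translate {u φ : Eucl n → ℝ} (hu : LocallyIntegrable u)
    (hφ : ContDiff ℝ ((⊤ : ℕ∞) : WithTop ℕ∞) φ) (hφc : HasCompactSupport φ) :
    ∃ b : Eucl n → ℝ, Integrable b ∧ ∀ h x : Eucl n, ‖h‖ ≤ 1 →
      ‖u x * (φ x - φ (x + h))‖ ≤ b x * ‖h‖ := by
  obtain ⟨C, hC⟩ := hφ.lipschitzWith_of_hasCompactSupport hφc (by simp)
  obtain ⟨R, hR⟩ := hφc.isCompact.isBounded.subset_closedBall 0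
  set K : Set (Eucl n) := closedBall 0 (R + 1) with hK
  have hwK : Integrable (K.indicator u) :=
    (hu.integrableOn_isCompact (isCompact_closedBall _ _)).integrable_indicator
      measurableSet_closedBall
  have hout : ∀ y, φ y ≠ 0 → ‖y‖ ≤ R := fun y hy => by
    simpa using hR (subset_tsupport _ hy)
  refine ⟨fun x => ‖K.indicator u x‖ * C, hwK.norm.mul_const _, fun h x hh => ?_⟩
  by_cases hx : x ∈ K
  · simp only [Set.indicator_of_mem hx]
    rw [norm_mul, mul_assoc]
    gcongr
    have := hC.norm_sub_le x (x + h)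
    simpa using this
  · have hx' : R + 1 < ‖x‖ := by simpa [hK] using hx
    have h1 : φ x = 0 := by
      by_contra h0
      linarith [hout x h0]
    have h2 : φ (x + h) = 0 := by
      by_contra h0
      have h3 := hout _ h0
      have h4 : ‖x‖ ≤ ‖x + h‖ + ‖h‖ := by simpa using norm_sub_le (x + h) h
      linarith
    rw [h1, h2]
    simp only [sub_zero, mul_zero, norm_zero]
    positivity

theorem tendsto_integral_radial_quotient {u φ : Eucl n → ℝ} (hu : LocallyIntegrable u)
    (hφ : ContDiff ℝ ((⊤ : ℕ∞) : WithTop ℕ∞) φ) (hφc : HasCompactSupport φ) (ω : USphere n) :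
    Tendsto (fun r : ℝ => r⁻¹ * ∫ x, u x * (φ x - φ (x + r • (ω : Eucl n)))) (𝓝[>] 0)
      (𝓝 (-∫ x, u x * fderiv ℝ φ x ω)) := by
  obtain ⟨b, hb, hbound⟩ := exists_integrable_bound_sub_translate hu hφ hφc
  simp_rw [← integral_const_mul]
  rw [← integral_neg]
  refine tendsto_integral_filter_of_dominated_convergence b ?_ ?_ hb ?_
  · refine Eventually.of_forall fun r => ?_
    refine (hu.aestronglyMeasurable.mul ?_).const_mul _
    exact (hφ.continuous.sub (hφ.continuous.comp (continuous_add_const _))).aestronglyMeasurable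
  · have h1 : ∀ᶠ r : ℝ in 𝓝[>] 0, r < 1 := nhdsWithin_le_nhds (gt_mem_nhds one_pos)
    filter_upwards [self_mem_nhdsWithin, h1] with r hr hr1
    have hr0 : 0 < r := hr
    refine Eventually.of_forall fun x => ?_
    have := hbound (r • (ω : Eucl n)) x (by rw [norm_smul_sphere hr0.le]; exact hr1.le)
    rw [norm_smul_sphere hr0.le] at this
    rw [norm_mul, norm_inv, Real.norm_of_nonneg hr0.le, inv_mul_le_iff₀ hr0, mul_comm r]
    exact this
  · refine Eventually.of_forall fun x => ?_
    have h1 := ((hφ.differentiable (by simp)) x).hasFDerivAt.hasLineDerivAt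
      (ω : Eucl n) |>.tendsto_slope_zero_right
    have h2 := (h1.const_mul (u x)).neg
    refine h2.congr fun r => ?_
    simp only [smul_eq_mul]
    ring

/-- The dual pairing of the averaged difference quotients with a test function, for a fixed
translation `h`. -/
noncomputable def quotPairing (u φ : Eucl n → ℝ) (v h : Eucl n) : ℝ :=
  (inner ℝ v h / ‖h‖) * ∫ x, diffQuot u (x, h) * φ x

theorem quotPairing_eq {u φ : Eucl n → ℝ} (hu : LocallyIntegrable u) (hφ : Continuous φ)
    (hφc : HasCompactSupport φ) (v h : Eucl n) :
    quotPairing u φ v h = (inner ℝ v h / ‖h‖) * (‖h‖⁻¹ * ∫ x, u x * (φ x - φ (x + h))) := by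
  rw [quotPairing, ← integral_mul_sub_translate hu hφ hφc, ← integral_const_mul ‖h‖⁻¹]
  congr 2
  ext x
  rw [diffQuot]
  ring

theorem measurable_quotPairing {u φ : Eucl n → ℝ} (hu : Measurable u) (hφ : Measurable φ)
    (v : Eucl n) : Measurable (quotPairing u φ v) := by
  have h1 : Measurable fun z : Eucl n × Eucl n => diffQuot u (z.2, z.1) * φ z.2 :=
    ((measurable_diffQuot hu).comp measurable_swap).mul (hφ.comp measurable_snd)
  have h2 : StronglyMeasurable fun h : Eucl n => ∫ x, diffQuot u (x, h) * φ x :=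
    h1.stronglyMeasurable.integral_prod_right'
  exact ((measurable_const.inner measurable_id).div measurable_norm).mul h2.measurable

theorem abs_inner_div_norm_le (v h : Eucl n) : |inner ℝ v h / ‖h‖| ≤ ‖v‖ := by
  rw [abs_div, abs_norm]
  exact div_le_of_le_mul₀ (norm_nonneg _) (norm_nonneg _) (abs_real_inner_le_norm _ _)

theorem ae_polarKernel_mem_ball (hn : 1 ≤ n) {κ : ℝ} (hκ : 0 < κ) :
    ∀ᵐ h ∂(polarKernel n κ), h ∈ ball (0 : Eucl n) 1 := by
  rw [polarKernel_eq_withDensity hn hκ]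
  exact (withDensity_absolutelyContinuous _ _).ae_le (ae_restrict_mem measurableSet_ball)

theorem integrable_inner_smul_sphere (v : Eucl n) : Integrable (fun ω : USphere n =>
    (inner ℝ v (ω : Eucl n) : ℝ) • (ω : Eucl n)) (surfaceMeasure n) :=
  Continuous.integrable_of_hasCompactSupport (by fun_prop) (HasCompactSupport.of_compactSpace _)

/-- The second moment matrix of the sphere, as a linear map. -/
noncomputable def sphereMoment (n : ℕ) : Eucl n →ₗ[ℝ] Eucl n where
  toFun v := ∫ ω : USphere n, (inner ℝ v (ω : Eucl n) : ℝ) • (ω : Eucl n) ∂(surfaceMeasure n)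
  map_add' v w := by
    rw [← integral_add (integrable_inner_smul_sphere v) (integrable_inner_smul_sphere w)]
    simp_rw [inner_add_left, add_smul]
  map_smul' c v := by
    simp_rw [inner_smul_left, mul_smul]
    exact integral_smul c _

/-- `⟨v, sphereMoment n v⟩ = ∫ ⟨v, ω⟩²` is positive for `v ≠ 0`, the integrand being nonzero at `v /
‖v‖`; in finite dimension injectivity suffices. -/
theorem sphereMoment_surjective (n : ℕ) : Function.Surjective (sphereMoment n) := by
  refine LinearMap.surjective_of_injective ((injective_iff_map_eq_zero _).2 fun v hv => ?_)
  by_contra hv0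
  have h1 : inner ℝ v (sphereMoment n v) =
      ∫ ω : USphere n, (inner ℝ v (ω : Eucl n) : ℝ) ^ 2 ∂(surfaceMeasure n) := by
    change inner ℝ v (∫ ω : USphere n, _ ∂(surfaceMeasure n)) = _
    rw [← integral_inner (integrable_inner_smul_sphere v)]
    congr 1
    ext ω
    rw [inner_smul_right, sq]
  have hpos : 0 < ∫ ω : USphere n, (inner ℝ v (ω : Eucl n) : ℝ) ^ 2 ∂(surfaceMeasure n) := by
    have hvn : ‖v‖ ≠ 0 := norm_ne_zero_iff.2 hv0
    refine Continuous.integral_pos_of_hasCompactSupport_nonneg_nonzero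
      (x := ⟨‖v‖⁻¹ • v, by simp [norm_smul, hvn]⟩) (by fun_prop)
      (HasCompactSupport.of_compactSpace _) (fun ω => by positivity) ?_
    simp [inner_smul_right, hvn]
  rw [hv, inner_zero_right] at h1
  linarith

/-- Limit of the pairings of averaged difference quotients with a test function. -/
theorem tendsto_integral_quotPairing (hn : 1 ≤ n) {u φ : Eucl n → ℝ} (hu : LocallyIntegrable u)
    (hum : Measurable u)
    (hφ : ContDiff ℝ ((⊤ : ℕ∞) : WithTop ℕ∞) φ) (hφc : HasCompactSupport φ) (v : Eucl n) :
    Tendsto (fun κ => ∫ h, quotPairing u φ v h ∂(polarKernel n κ)) (𝓝[>] 0)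
      (𝓝 (-∫ x, u x * fderiv ℝ φ x (sphereMoment n v))) := by
  obtain ⟨b, hb, hbound⟩ := exists_integrable_bound_sub_translate hu hφ hφc
  have hb0 : 0 ≤ ∫ x, |b x| := integral_nonneg fun x => abs_nonneg _
  have hq := quotPairing_eq hu hφ.continuous hφc v
  -- The majorant is available only for `‖h‖ ≤ 1`; cutting off costs nothing because the kernels
  -- live on the unit ball.
  set f : Eucl n → ℝ := (ball (0 : Eucl n) 1).indicator (quotPairing u φ v) with hf
  have hfm : Measurable f :=
    (measurable_quotPairing hum hφ.continuous.measurable v).indicator measurableSet_ball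
  have hfM : ∀ h, |f h| ≤ ‖v‖ * ∫ x, |b x| := by
    intro h
    by_cases hh : h ∈ ball (0 : Eucl n) 1
    · rw [hf, Set.indicator_of_mem hh, hq, abs_mul]
      gcongr
      · exact abs_inner_div_norm_le v h
      · rw [mem_ball_zero_iff] at hh
        rw [abs_mul, abs_inv, abs_norm]
        refine inv_mul_le_of_le_mul₀ (norm_nonneg _) hb0 ?_
        rw [mul_comm, ← integral_mul_const]
        refine (Real.norm_eq_abs _).symm.trans_le <| norm_integral_le_of_norm_le (hb.abs.mul_const _) (Eventually.of_forall fun x => ?_)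
        refine (hbound h x hh.le).trans ?_
        gcongr
        exact le_abs_self _
    · rw [hf, Set.indicator_of_notMem hh, abs_zero]
      positivity
  have hlim := tendsto_integral_polarKernel hfm hfM
    (b := fun ω : USphere n => inner ℝ v (ω : Eucl n) * -∫ x, u x * fderiv ℝ φ x ω)
    (Eventually.of_forall fun ω η hη => by
      have h1 := (tendsto_integral_radial_quotient hu hφ hφc ω).const_mul
        (inner ℝ v (ω : Eucl n) : ℝ)
      have h2 := Metric.tendsto_nhds.1 h1 η hη
      obtain ⟨δ, hδ, h3⟩ := mem_nhdsGT_iff_exists_Ioo_subset.1 h2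
      refine ⟨δ, hδ, ?_⟩
      filter_upwards [ae_restrict_mem measurableSet_Ioo] with r hr hrδ
      have h4 := h3 ⟨hr.1, hrδ⟩
      have h5 : f (r • (ω : Eucl n)) = inner ℝ v (ω : Eucl n) *
          (r⁻¹ * ∫ x, u x * (φ x - φ (x + r • (ω : Eucl n)))) := by
        rw [hf, Set.indicator_of_mem, hq, norm_smul_sphere hr.1.le, inner_smul_right,
          mul_div_cancel_left₀ _ hr.1.ne']
        rw [mem_ball_zero_iff, norm_smul_sphere hr.1.le]
        exact hr.2
      rw [h5]
      exact le_of_lt h4)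
  have hval : ∫ ω : USphere n, (inner ℝ v (ω : Eucl n) * -∫ x, u x * fderiv ℝ φ x ω)
      ∂(surfaceMeasure n) = -∫ x, u x * fderiv ℝ φ x (sphereMoment n v) := by
    -- The radial limit is linear in `ω` through the functional `T = ∫ u dφ`, which therefore comes
    -- out of the sphere integral and leaves the second moment.
    simp_rw [← integral_smul_fderiv_apply hu hφ hφc]
    set T := ∫ x, u x • fderiv ℝ φ x
    change _ = -T (∫ ω : USphere n, (inner ℝ v (ω : Eucl n) : ℝ) • (ω : Eucl n) ∂(surfaceMeasure n))
    rw [← T.integral_comp_comm (integrable_inner_smul_sphere v), ← integral_neg]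
    simp
  rw [hval] at hlim
  refine hlim.congr' ?_
  filter_upwards [self_mem_nhdsWithin] with κ hκ
  refine integral_congr_ae ?_
  filter_upwards [ae_polarKernel_mem_ball hn hκ] with h hh
  rw [hf, Set.indicator_of_mem hh]

/-- Averaged difference quotients bounded in `L^p` produce weak derivatives. -/
theorem exists_weak_directional_derivative (hn : 1 ≤ n) (hp : 1 < p) {u : Eucl n → ℝ}
    (hum : Measurable u) (hu : MemLp u (ENNReal.ofReal p)) {κ : ℕ → ℝ}
    (hκ : Tendsto κ atTop (𝓝[>] 0)) (hκ0 : ∀ k, 0 < κ k) {B : ℝ≥0∞} (hB : B ≠ ∞)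
    (hbd : ∀ k, ∫⁻ z, ‖diffQuot u z‖ₑ ^ p
      ∂((volume : Measure (Eucl n)).prod (polarKernel n (κ k))) ≤ B) (w : Eucl n) :
    ∃ g : Eucl n → ℝ, MemLp g (ENNReal.ofReal p) ∧
      ∀ φ : Eucl n → ℝ, ContDiff ℝ ((⊤ : ℕ∞) : WithTop ℕ∞) φ → HasCompactSupport φ →
        ∫ x, u x * fderiv ℝ φ x w = -∫ x, g x * φ x := by
  have hp0 : 0 < p := by linarith
  have hp' : 1 ≤ ENNReal.ofReal p := by simpa using hp.le
  have hpq := Real.HolderConjugate.conjExponent hp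
  set q := p.conjExponent
  have hq0 := hpq.symm.pos
  have := hpq.ennreal_ofReal_holderConjugate
  have hul : LocallyIntegrable u := hu.locallyIntegrable hp'
  -- Weighting by `⟨v, h⟩/‖h‖` then isolates the derivative in direction `w` in the limit.
  obtain ⟨v, hv⟩ := sphereMoment_surjective n w
  have hfin : ∀ k, IsFiniteMeasure (polarKernel n (κ k)) := fun k =>
    isFiniteMeasure_polarKernel (hκ0 k)
  set F : Eucl n × Eucl n → ℝ := fun z => diffQuot u z * (inner ℝ v z.2 / ‖z.2‖) with hF
  have hFm : Measurable F := (measurable_diffQuot hum).mul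
    ((measurable_const.inner measurable_snd).div measurable_snd.norm)
  have hFle : ∀ z, ‖F z‖ₑ ^ p ≤ ‖v‖ₑ ^ p * ‖diffQuot u z‖ₑ ^ p := by
    intro z
    rw [← ENNReal.mul_rpow_of_nonneg _ _ hp0.le, mul_comm]
    gcongr
    simp only [hF, enorm_mul]
    gcongr
    rw [enorm_le_iff_norm_le]
    exact abs_inner_div_norm_le v z.2
  have hFint : ∀ k, ∫⁻ z, ‖F z‖ₑ ^ p ∂((volume : Measure (Eucl n)).prod (polarKernel n (κ k))) ≤
      ‖v‖ₑ ^ p * B := by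
    intro k
    refine (lintegral_mono hFle).trans ?_
    rw [lintegral_const_mul' _ _ (ENNReal.rpow_ne_top_of_nonneg hp0.le enorm_ne_top)]
    gcongr
    exact hbd k
  have hFp : ∀ k, MemLp F (ENNReal.ofReal p)
      ((volume : Measure (Eucl n)).prod (polarKernel n (κ k))) := by
    intro k
    refine ⟨hFm.aestronglyMeasurable, ?_⟩
    rw [← ENNReal.rpow_lt_top_iff_of_pos hp0, eLpNorm_rpow_eq_lintegral hp0]
    exact (hFint k).trans_lt (ENNReal.mul_lt_top
      (ENNReal.rpow_lt_top_of_nonneg hp0.le enorm_ne_top) hB.lt_top)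
  set G : ℕ → Eucl n → ℝ := fun k x => ∫ h, F (x, h) ∂(polarKernel n (κ k)) with hG
  set D : ℝ≥0∞ := (surfaceMeasure n Set.univ ^ (p - 1) * (‖v‖ₑ ^ p * B)) with hD
  have hDtop : D ≠ ∞ := by
    refine ENNReal.mul_ne_top (ENNReal.rpow_ne_top_of_nonneg (by linarith) (measure_ne_top _ _))
      (ENNReal.mul_ne_top (ENNReal.rpow_ne_top_of_nonneg hp0.le enorm_ne_top) hB)
  have hGint : ∀ k, eLpNorm (G k) (ENNReal.ofReal p) volume ≤ D ^ (1 / p) := by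
    intro k
    rw [one_div, ENNReal.le_rpow_inv_iff hp0, eLpNorm_rpow_eq_lintegral hp0]
    refine (lintegral_enorm_integral_rpow_le hp.le hFm).trans ?_
    rw [polarKernel_univ (hκ0 k), hD, ← lintegral_prod_symm _ (hFm.enorm.pow_const p).aemeasurable]
    gcongr
    exact hFint k
  have hDtop' : D ^ (1 / p) ≠ ∞ := ENNReal.rpow_ne_top_of_nonneg (by positivity) hDtop
  have hGp : ∀ k, MemLp (G k) (ENNReal.ofReal p) := fun k =>
    ⟨hFm.aestronglyMeasurable.integral_prod_right' (ν := polarKernel n (κ k)),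
      (hGint k).trans_lt hDtop'.lt_top⟩
  obtain ⟨g, hg, hgw⟩ := exists_memLp_weak_cluster hpq hGp (C := (D ^ (1 / p)).toReal) fun k => by
    rw [ENNReal.ofReal_toReal hDtop']
    exact hGint k
  refine ⟨g, hg, fun φ hφ hφc => ?_⟩
  have hφq : MemLp φ (ENNReal.ofReal q) := hφ.continuous.memLp_of_hasCompactSupport hφc
  rw [hgw φ (-∫ x, u x * fderiv ℝ φ x w) hφq, neg_neg]
  have hlim := (tendsto_integral_quotPairing hn hul hum hφ hφc v).comp hκ
  rw [hv] at hlim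
  refine hlim.congr fun k => ?_
  -- Hölder on the product: `φ` remains in `L^q` there because the kernel is a finite measure.
  have hi : Integrable (Function.uncurry fun x h => F (x, h) * φ x)
      ((volume : Measure (Eucl n)).prod (polarKernel n (κ k))) :=
    (hFp k).integrable_mul (hφq.comp_fst (polarKernel n (κ k)))
  calc ∫ h, quotPairing u φ v h ∂(polarKernel n (κ k))
      = ∫ h, (∫ x, F (x, h) * φ x) ∂(polarKernel n (κ k)) := by
        refine integral_congr_ae (Eventually.of_forall fun h => ?_)
        simp only [quotPairing, hF]
        rw [← integral_const_mul]
        congr 1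
        ext x
        ring
    _ = ∫ x, ∫ h, F (x, h) * φ x ∂(polarKernel n (κ k)) := (integral_integral_swap hi).symm
    _ = ∫ x, G k x * φ x := by simp_rw [integral_mul_const, hG]

theorem exists_isWeakGradient (hn : 1 ≤ n) (hp : 1 < p) {u : Eucl n → ℝ}
    (hum : Measurable u) (hu : MemLp u (ENNReal.ofReal p)) {κ : ℕ → ℝ}
    (hκ : Tendsto κ atTop (𝓝[>] 0)) (hκ0 : ∀ k, 0 < κ k) {B : ℝ≥0∞} (hB : B ≠ ∞)
    (hbd : ∀ k, ∫⁻ z, ‖diffQuot u z‖ₑ ^ p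
      ∂((volume : Measure (Eucl n)).prod (polarKernel n (κ k))) ≤ B) :
    ∃ g : Eucl n → Eucl n, IsWeakGradient u g ∧ MemLp g (ENNReal.ofReal p) := by
  have hp' : 1 ≤ ENNReal.ofReal p := by simpa using hp.le
  set b := EuclideanSpace.basisFun (Fin n) ℝ
  choose g hg hgw using fun i : Fin n =>
    exists_weak_directional_derivative hn hp hum hu hκ hκ0 hB hbd (b i)
  have hul : LocallyIntegrable u := hu.locallyIntegrable hp'
  refine ⟨fun x => ∑ i, g i x • b i, fun φ hφ hφc v => ?_, ?_⟩
  · have hgi : ∀ i, Integrable fun x => g i x * φ x := fun i =>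
      ((hg i).locallyIntegrable hp').integrable_smul_right_of_hasCompactSupport hφ.continuous hφc
    have h1 : ∀ x, φ x * inner ℝ (∑ i, g i x • b i) v =
        ∑ i, (inner ℝ (b i) v : ℝ) * (g i x * φ x) := by
      intro x
      rw [sum_inner, Finset.mul_sum]
      refine Finset.sum_congr rfl fun i _ => ?_
      rw [real_inner_smul_left]
      ring
    simp_rw [h1]
    rw [integral_finsetSum _ fun i _ => (hgi i).const_mul _]
    simp_rw [integral_const_mul]
    rw [← integral_smul_fderiv_apply hul hφ hφc, ← Finset.sum_neg_distrib]
    conv_lhs => rw [← b.sum_repr' v]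
    rw [map_sum]
    refine Finset.sum_congr rfl fun i _ => ?_
    rw [map_smul, integral_smul_fderiv_apply hul hφ hφc, hgw i φ hφ hφc, smul_eq_mul, mul_neg]
  · refine memLp_finsetSum _ fun i _ => ?_
    exact MemLp.of_le (hg i) ((hg i).1.smul_const _) (Eventually.of_forall fun x => by
      simp [norm_smul])

end Characterization

/-! ### Measurable representatives and assembly. -/

section Main

variable {n : ℕ} {p : ℝ}

/-- Clamping a measurable representative to `[mlo, mhi]` alters it only on a null set and makes the
bounds hold everywhere. -/
theorem KernelBounded.exists_measurable {m : Eucl n × Eucl n → ℝ} (h : KernelBounded m)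
    (hm : AEStronglyMeasurable m) :
    ∃ (m' : Eucl n × Eucl n → ℝ) (mlo mhi : ℝ), Measurable m' ∧ m =ᵐ[volume] m' ∧ 0 < mlo ∧
      ∀ z, mlo ≤ m' z ∧ m' z ≤ mhi := by
  obtain ⟨mlo, mhi, h0, h1, h2⟩ := h
  refine ⟨fun z => max mlo (min mhi (hm.mk m z)), mlo, mhi, ?_, ?_, h0, fun z => ⟨?_, ?_⟩⟩
  · exact measurable_const.max (measurable_const.min hm.stronglyMeasurable_mk.measurable)
  · filter_upwards [h2, hm.ae_eq_mk] with z hz hz'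
    rw [← hz', min_eq_right hz.2, max_eq_right hz.1]
  · exact le_max_left _ _
  · exact max_le h1 (min_le_left _ _)

theorem IsWeakGradient.congr_ae {u u' : Eucl n → ℝ} {g g' : Eucl n → Eucl n}
    (h : IsWeakGradient u g) (hu : u =ᵐ[volume] u') (hg : g =ᵐ[volume] g') :
    IsWeakGradient u' g' := by
  intro φ hφ hφc v
  have e1 : ∫ x, u' x * fderiv ℝ φ x v = ∫ x, u x * fderiv ℝ φ x v :=
    integral_congr_ae (by filter_upwards [hu] with x hx; rw [hx])
  have e2 : ∫ x, φ x * inner ℝ (g' x) v = ∫ x, φ x * inner ℝ (g x) v :=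
    integral_congr_ae (by filter_upwards [hg] with x hx; rw [hx])
  rw [e1, e2]
  exact h φ hφ hφc v

theorem tendsto_anisoEnergy_of_isWeakGradient (hn : 1 ≤ n) (hp : 1 ≤ p)
    {m : Eucl n × Eucl n → ℝ} (hm : Measurable m) {M : ℝ} (hm0 : ∀ z, 0 ≤ m z)
    (hM : ∀ z, m z ≤ M) {a : Eucl n → USphere n → ℝ}
    (ha : ∀ᵐ x : Eucl n, ∀ᵐ ω : USphere n ∂(surfaceMeasure n), ∀ η > 0, ∃ δ > 0,
      ∀ᵐ r ∂(volume.restrict (Set.Ioo (0 : ℝ) 1)), r < δ →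
        |m (x, r • (ω : Eucl n)) - a x ω| ≤ η)
    {u : Eucl n → ℝ} {g : Eucl n → Eucl n} (hug : IsWeakGradient u g) (hum : Measurable u)
    (hgm : Measurable g) (hu : MemLp u (ENNReal.ofReal p)) (hg : MemLp g (ENNReal.ofReal p)) :
    Integrable (fun x => limitDensity p a x (g x)) ∧
      Tendsto (fun s : ℝ => ENNReal.ofReal (1 - s) * anisoEnergy m s p u) (𝓝[<] 1)
        (𝓝 (ENNReal.ofReal (∫ x, limitDensity p a x (g x)))) := by
  have hp0 : 0 < p := by linarith
  obtain ⟨hi, hlin⟩ := tendsto_linear_energy hp hm hm0 hM ha hgm hg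
  refine ⟨hi, ?_⟩
  have hnear := (tendsto_near_energy hp hm hm0 hM hug hum hgm hu hg hlin).comp
    (tendsto_mul_one_sub hp0)
  have h1 := (ENNReal.Tendsto.const_mul (a := ENNReal.ofReal (1 / p)) hnear
    (Or.inr ENNReal.ofReal_ne_top)).add (tendsto_far_energy hp hM hum hu)
  rw [add_zero, ← ENNReal.ofReal_mul (by positivity), integral_const_mul, ← mul_assoc,
    one_div_mul_cancel hp0.ne', one_mul] at h1
  refine h1.congr' ?_
  filter_upwards [self_mem_nhdsWithin] with s hs
  rw [anisoEnergy_eq_near_add_far, mul_add, near_energy_eq hn hp hm hum hs]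
  rfl

theorem exists_isWeakGradient_of_not_tendsto_top (hn : 1 ≤ n) (hp : 1 < p)
    {m : Eucl n × Eucl n → ℝ} (hm : Measurable m) {c : ℝ} (hc : 0 < c) (hcm : ∀ z, c ≤ m z)
    {u : Eucl n → ℝ} (hum : Measurable u) (hu : MemLp u (ENNReal.ofReal p))
    (h : ¬ Tendsto (fun s : ℝ => ENNReal.ofReal (1 - s) * anisoEnergy m s p u) (𝓝[<] 1) (𝓝 ⊤)) :
    ∃ g : Eucl n → Eucl n, IsWeakGradient u g ∧ MemLp g (ENNReal.ofReal p) := by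
  have hp0 : 0 < p := by linarith
  rw [ENNReal.tendsto_nhds_top_iff_nnreal] at h
  push Not at h
  obtain ⟨B, hB⟩ := h
  -- Failure of divergence means that some finite `B` bounds the energies frequently as `s ↑ 1`,
  -- hence along a sequence; the shift by `N` below puts all its terms under `1`.
  obtain ⟨s, hs, hsB⟩ := exists_seq_forall_of_frequently hB
  obtain ⟨N, hN⟩ := eventually_atTop.1 (tendsto_nhdsWithin_iff.1 hs).2
  have hN1 : ∀ k, s (k + N) < 1 := fun k => hN _ (by omega)
  refine exists_isWeakGradient hn hp hum hu (κ := fun k => p * (1 - s (k + N)))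
    ((tendsto_mul_one_sub hp0).comp (hs.comp (tendsto_add_atTop_nat N)))
    (fun k => mul_pos hp0 (sub_pos.2 (hN1 k)))
    -- From `m ≥ c` and the factor `1 / p` of the near energy.
    (B := (ENNReal.ofReal (1 / p * c))⁻¹ * B)
    (ENNReal.mul_ne_top (by simp; positivity) ENNReal.coe_ne_top) fun k => ?_
  have h0 : ENNReal.ofReal (1 / p * c) ≠ 0 := by
    have : 0 < 1 / p * c := by positivity
    simpa using this
  rw [← ENNReal.div_eq_inv_mul, ENNReal.le_div_iff_mul_le (Or.inl h0)
    (Or.inl ENNReal.ofReal_ne_top), mul_comm]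
  refine le_trans ?_ (hsB (k + N))
  rw [anisoEnergy_eq_near_add_far, mul_add, near_energy_eq hn hp.le hm hum (hN1 k)]
  refine le_trans ?_ le_self_add
  rw [ENNReal.ofReal_mul (by positivity), mul_assoc, ← lintegral_const_mul' _ _
    ENNReal.ofReal_ne_top]
  gcongr with z
  rw [ENNReal.ofReal_mul (hc.le.trans (hcm z)), ← ENNReal.ofReal_rpow_of_nonneg (abs_nonneg _)
    hp0.le, ← Real.norm_eq_abs, ofReal_norm]
  gcongr
  exact hcm z

end Main

theorem theorem3p2 (n : ℕ) (hn : 1 ≤ n) (p : ℝ) (hp : 1 ≤ p)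
    (m : Eucl n × Eucl n → ℝ) (a : Eucl n → USphere n → ℝ)
    (hm : MemLp m ∞ (volume : Measure (Eucl n × Eucl n)))
    (h1 : KernelBounded m) (h2 : KernelSymmetric m) (h3 : HasRadialLimit m a)
    (u : Eucl n → ℝ) (hu : MemLp u (ENNReal.ofReal p)) :
    (∀ g : Eucl n → Eucl n, IsWeakGradient u g → MemLp g (ENNReal.ofReal p) →
      Integrable (fun x => limitDensity p a x (g x)) ∧
      Tendsto (fun s : ℝ => ENNReal.ofReal (1 - s) * anisoEnergy m s p u) (𝓝[<] 1)
        (𝓝 (ENNReal.ofReal (∫ x, limitDensity p a x (g x))))) ∧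
    (1 < p → ¬ MemW1p p u →
      Tendsto (fun s : ℝ => ENNReal.ofReal (1 - s) * anisoEnergy m s p u) (𝓝[<] 1) (𝓝 ⊤)) := by
  obtain ⟨m', mlo, mhi, hm', hmm', hlo, hb⟩ := h1.exists_measurable hm.1
  have hu' : MemLp (hu.1.mk u) (ENNReal.ofReal p) := hu.ae_eq hu.1.ae_eq_mk
  have hum : Measurable (hu.1.mk u) := hu.1.stronglyMeasurable_mk.measurable
  simp_rw [anisoEnergy_congr_ae hmm' hu.1.ae_eq_mk]
  refine ⟨fun g hug hg => ?_, fun hp1 hnot => ?_⟩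
  · have hg' : MemLp (hg.1.mk g) (ENNReal.ofReal p) := hg.ae_eq hg.1.ae_eq_mk
    obtain ⟨hi, ht⟩ := tendsto_anisoEnergy_of_isWeakGradient hn hp hm'
      (fun z => hlo.le.trans (hb z).1) (fun z => (hb z).2) (h3.eventually_polar hn hmm')
      (hug.congr_ae hu.1.ae_eq_mk hg.1.ae_eq_mk) hum hg.1.stronglyMeasurable_mk.measurable hu' hg'
    have e : (fun x => limitDensity p a x (hg.1.mk g x)) =ᵐ[volume]
        fun x => limitDensity p a x (g x) := by
      filter_upwards [hg.1.ae_eq_mk] with x hx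
      rw [← hx]
    rw [integral_congr_ae e] at ht
    exact ⟨hi.congr e, ht⟩
  · by_contra hT
    obtain ⟨g, hug, hg⟩ := exists_isWeakGradient_of_not_tendsto_top hn hp1 hm' hlo
      (fun z => (hb z).1) hum hu' hT
    exact hnot ⟨hu, g, hug.congr_ae hu.1.ae_eq_mk.symm (EventuallyEq.refl _ _), hg⟩
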